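/- Let $A$ be a unital $C^*$-algebra and let $\alpha\colon\mathbb{T}\to\mathrm{Aut}(A)$ be a (point-norm) continuous action of the circle with the Rokhlin property: for every $\varepsilon>0$ and every finite subset $F\subseteq A$ there is a unitary $u\in A$ such that $\|\alpha_\zeta(u)-\zeta u\|<\varepsilon$ for all $\zeta\in\mathbb{T}$ and $\|ua-au\|<\varepsilon$ for all $a\in F$. Let $A^\alpha=\{a\in A:\alpha_\zeta(a)=a \text{ for all } \zeta\in\mathbb{T}\}$ be the fixed point algebra and let $\iota\colon A^\alpha\hookrightarrow A$ be the inclusion. Then: \begin{enumerate} \item For $j=0,1$, the group homomorphism $K_j(\iota)\colon K_j(A^\alpha)\to K_j(A)$ is injective. \item For each $j\in\{0,1\}$ such that $K_j(A)$ is finitely generated, there exists a group homomorphism $\pi\colon K_j(A)\to K_j(A^\alpha)$ such that $\pi\circ K_j(\iota)=\mathrm{id}_{K_j(A^\alpha)}$. \item For $j=0,1$, without any finite generation assumption, the image $K_j(\iota)(K_j(A^\alpha))$ is a pure subgroup of $K_j(A)$, where a subgroup $G'$ of an abelian group $G$ is called pure if every torsion element of $G/G'$ lifts to a torsion element of $G$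 of the same order. \end{enumerate} -/

import Mathlib

open scoped Matrix CStarAlgebra

noncomputable section

/-! ### Murray–von Neumann equivalence and `K₀` -/

namespace CStarK

section Projections

variable {A : Type*} [CStarAlgebra A]

/-- Murray–von Neumann equivalence of square matrices `p`, `q` (possibly of different sizes) over
`A`: there is a rectangular matrix `v` with `v v* = p` and `v* v = q`. -/
def MvN {m n : Type*} [Fintype m] [Fintype n] (p : Matrix m m A) (q : Matrix n n A) : Prop :=
  ∃ v : Matrix m n A, v * vᴴ = p ∧ vᴴ * v = q

/-- The block diagonal sum `diag(p, q)`. -/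
def dsum {m n : ℕ} (p : Matrix (Fin m) (Fin m) A) (q : Matrix (Fin n) (Fin n) A) :
    Matrix (Fin (m + n)) (Fin (m + n)) A :=
  Matrix.reindex finSumFinEquiv finSumFinEquiv (Matrix.fromBlocks p 0 0 q)

variable (A) in
/-- All projections in all matrix algebras `M_n(A)`. -/
def Proj : Type _ := Σ n : ℕ, {p : Matrix (Fin n) (Fin n) A // IsStarProjection p}

section lemmas

variable {l m n k : Type*} [Fintype l] [Fintype m] [Fintype n] [Fintype k]

lemma MvN.refl {p : Matrix m m A} (hp : IsStarProjection p) : MvN p p := by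
  have h1 : pᴴ = p := hp.isSelfAdjoint
  exact ⟨p, by rw [h1]; exact hp.isIdempotentElem, by rw [h1]; exact hp.isIdempotentElem⟩

lemma MvN.symm {p : Matrix m m A} {q : Matrix n n A} (h : MvN p q) : MvN q p := by
  obtain ⟨v, h1, h2⟩ := h
  exact ⟨vᴴ, by simpa using h2, by simpa using h1⟩

lemma MvN.trans {p : Matrix l l A} {q : Matrix m m A} {r : Matrix n n A}
    (hp : IsStarProjection p) (hr : IsStarProjection r) (h : MvN p q) (h' : MvN q r) :
    MvN p r := by
  obtain ⟨v, h1, h2⟩ := h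
  obtain ⟨w, h3, h4⟩ := h'
  refine ⟨v * w, ?_, ?_⟩
  · calc v * w * (v * w)ᴴ = v * (w * wᴴ) * vᴴ := by
          simp only [Matrix.conjTranspose_mul, Matrix.mul_assoc]
      _ = (v * vᴴ) * (v * vᴴ) := by rw [h3, ← h2]; simp only [Matrix.mul_assoc]
      _ = p := by rw [h1]; exact hp.isIdempotentElem
  · calc (v * w)ᴴ * (v * w) = wᴴ * (vᴴ * v) * w := by
          simp only [Matrix.conjTranspose_mul, Matrix.mul_assoc]
      _ = (wᴴ * w) * (wᴴ * w) := by rw [h2, ← h3]; simp only [Matrix.mul_assoc]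
      _ = r := by rw [h4]; exact hr.isIdempotentElem

lemma MvN.reindex {p : Matrix m m A} (hp : IsStarProjection p) (e : m ≃ n) :
    MvN p (Matrix.reindex e e p) := by
  have h1 : pᴴ = p := hp.isSelfAdjoint
  have h2 : p * p = p := hp.isIdempotentElem
  refine ⟨p.submatrix id e.symm, ?_, ?_⟩
  · rw [Matrix.conjTranspose_submatrix, h1, Matrix.submatrix_mul_equiv, h2]; rfl
  · rw [Matrix.conjTranspose_submatrix, h1]
    have := Matrix.submatrix_mul_equiv p p e.symm (Equiv.refl m) e.symm
    simp only [Equiv.coe_refl] at this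
    rw [this, h2]; rfl

lemma MvN.blocks {p : Matrix l l A} {q : Matrix m m A} {r : Matrix n n A} {s : Matrix k k A}
    (h : MvN p q) (h' : MvN r s) :
    MvN (Matrix.fromBlocks p 0 0 r) (Matrix.fromBlocks q 0 0 s) := by
  obtain ⟨v, rfl, rfl⟩ := h
  obtain ⟨w, rfl, rfl⟩ := h'
  exact ⟨Matrix.fromBlocks v 0 0 w,
    by simp [Matrix.fromBlocks_conjTranspose, Matrix.fromBlocks_multiply],
    by simp [Matrix.fromBlocks_conjTranspose, Matrix.fromBlocks_multiply]⟩

lemma isStarProjection_reindex {p : Matrix m m A} (hp : IsStarProjection p) (e : m ≃ n) :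
    IsStarProjection (Matrix.reindex e e p) := by
  have h1 : pᴴ = p := hp.isSelfAdjoint
  have h2 : p * p = p := hp.isIdempotentElem
  refine ⟨?_, ?_⟩
  · change Matrix.reindex e e p * Matrix.reindex e e p = Matrix.reindex e e p
    rw [Matrix.reindex_apply, Matrix.submatrix_mul_equiv, h2]
  · change (Matrix.reindex e e p)ᴴ = Matrix.reindex e e p
    rw [Matrix.conjTranspose_reindex, h1]

lemma isStarProjection_blocks {p : Matrix m m A} {q : Matrix n n A} (hp : IsStarProjection p)
    (hq : IsStarProjection q) : IsStarProjection (Matrix.fromBlocks p 0 0 q) := by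
  have h1 : pᴴ = p := hp.isSelfAdjoint
  have h2 : p * p = p := hp.isIdempotentElem
  have h3 : qᴴ = q := hq.isSelfAdjoint
  have h4 : q * q = q := hq.isIdempotentElem
  refine ⟨?_, ?_⟩
  · simp [IsIdempotentElem, Matrix.fromBlocks_multiply, h2, h4]
  · change (Matrix.fromBlocks p 0 0 q)ᴴ = Matrix.fromBlocks p 0 0 q
    simp [Matrix.fromBlocks_conjTranspose, h1, h3]

end lemmas

lemma isStarProjection_dsum {m n : ℕ} {p : Matrix (Fin m) (Fin m) A} {q : Matrix (Fin n) (Fin n) A}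
    (hp : IsStarProjection p) (hq : IsStarProjection q) : IsStarProjection (dsum p q) :=
  isStarProjection_reindex (isStarProjection_blocks hp hq) _

lemma MvN.dsum_blocks {m n : ℕ} {p : Matrix (Fin m) (Fin m) A} {q : Matrix (Fin n) (Fin n) A}
    (hp : IsStarProjection p) (hq : IsStarProjection q) :
    MvN (dsum p q) (Matrix.fromBlocks p 0 0 q) :=
  (MvN.reindex (isStarProjection_blocks hp hq) _).symm

lemma MvN.dsum_congr {m n m' n' : ℕ} {p : Matrix (Fin m) (Fin m) A} {q : Matrix (Fin n) (Fin n) A}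
    {p' : Matrix (Fin m') (Fin m') A} {q' : Matrix (Fin n') (Fin n') A}
    (hp : IsStarProjection p) (hq : IsStarProjection q) (hp' : IsStarProjection p')
    (hq' : IsStarProjection q') (h : MvN p p') (h' : MvN q q') :
    MvN (dsum p q) (dsum p' q') := by
  have h1 := isStarProjection_dsum hp hq
  have h2 := isStarProjection_dsum hp' hq'
  exact ((MvN.dsum_blocks hp hq).trans h1 (isStarProjection_blocks hp' hq')
    (h.blocks h')).trans h1 h2 (MvN.dsum_blocks hp' hq').symm

variable (A) in
/-- Murray–von Neumann equivalence on the projections in matrix algebras over `A`. -/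
instance projSetoid : Setoid (Proj A) where
  r p q := MvN p.2.1 q.2.1
  iseqv := ⟨fun p => MvN.refl p.2.2, fun h => h.symm, fun {p _ r} h h' =>
    h.trans p.2.2 r.2.2 h'⟩

variable (A) in
/-- The semigroup `V(A)` of Murray–von Neumann classes of projections in matrix algebras over `A`,
with addition induced by block diagonal sum. -/
def V : Type _ := Quotient (projSetoid A)

namespace V

/-- The class of a projection in `M_n(A)`. -/
def mk {n : ℕ} (p : Matrix (Fin n) (Fin n) A) (hp : IsStarProjection p) : V A :=
  Quotient.mk (projSetoid A) ⟨n, p, hp⟩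

instance : Zero (V A) := ⟨mk (0 : Matrix (Fin 0) (Fin 0) A) (IsStarProjection.zero _)⟩

instance : Add (V A) :=
  ⟨Quotient.map₂ (fun p q => ⟨p.1 + q.1, dsum p.2.1 q.2.1, isStarProjection_dsum p.2.2 q.2.2⟩)
    (fun p p' h q q' h' => MvN.dsum_congr p.2.2 q.2.2 p'.2.2 q'.2.2 h h')⟩

lemma mk_add_mk {m n : ℕ} (p : Matrix (Fin m) (Fin m) A) (q : Matrix (Fin n) (Fin n) A)
    (hp : IsStarProjection p) (hq : IsStarProjection q) :
    mk p hp + mk q hq = mk (dsum p q) (isStarProjection_dsum hp hq) := rfl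

lemma mk_eq_mk {m n : ℕ} {p : Matrix (Fin m) (Fin m) A} {q : Matrix (Fin n) (Fin n) A}
    {hp : IsStarProjection p} {hq : IsStarProjection q} :
    mk p hp = mk q hq ↔ MvN p q :=
  Quotient.eq (r := projSetoid A)

lemma ind {P : V A → Prop} (h : ∀ (n : ℕ) (p : Matrix (Fin n) (Fin n) A) (hp), P (mk p hp))
    (x : V A) : P x :=
  Quotient.ind (fun p => h p.1 p.2.1 p.2.2) x

lemma add_comm' (x y : V A) : x + y = y + x := by
  induction x using V.ind with | _ m p hp
  induction y using V.ind with | _ n q hq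
  rw [mk_add_mk, mk_add_mk, mk_eq_mk]
  have h := MvN.reindex (isStarProjection_blocks hp hq) (Equiv.sumComm _ _)
  have e : Matrix.reindex (Equiv.sumComm (Fin m) (Fin n)) (Equiv.sumComm (Fin m) (Fin n))
      (Matrix.fromBlocks p 0 0 q) = Matrix.fromBlocks q 0 0 p := by
    ext (i | i) (j | j) <;> rfl
  rw [e] at h
  have h1 := isStarProjection_dsum hp hq
  exact ((MvN.dsum_blocks hp hq).trans h1 (isStarProjection_blocks hq hp) h).trans h1
    (isStarProjection_dsum hq hp) (MvN.dsum_blocks hq hp).symm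

lemma zero_add' (x : V A) : 0 + x = x := by
  induction x using V.ind with | _ n p hp
  change mk _ (IsStarProjection.zero _) + mk p hp = mk p hp
  rw [mk_add_mk, mk_eq_mk]
  have h0 : IsStarProjection (0 : Matrix (Fin 0) (Fin 0) A) := IsStarProjection.zero _
  have h := MvN.reindex (isStarProjection_blocks h0 hp) (Equiv.emptySum _ _)
  have e : Matrix.reindex (Equiv.emptySum (Fin 0) (Fin n)) (Equiv.emptySum (Fin 0) (Fin n))
      (Matrix.fromBlocks 0 0 0 p) = p := by
    ext i j; rfl
  rw [e] at h
  exact (MvN.dsum_blocks h0 hp).trans (isStarProjection_dsum h0 hp) hp h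

lemma add_assoc' (x y z : V A) : x + y + z = x + (y + z) := by
  induction x using V.ind with | _ l p hp
  induction y using V.ind with | _ m q hq
  induction z using V.ind with | _ n r hr
  simp only [mk_add_mk, mk_eq_mk]
  have hpq := isStarProjection_dsum hp hq
  have hqr := isStarProjection_dsum hq hr
  have b1 := isStarProjection_blocks (isStarProjection_blocks hp hq) hr
  have b2 := isStarProjection_blocks hp (isStarProjection_blocks hq hr)
  have h1 : MvN (dsum (dsum p q) r) (Matrix.fromBlocks (Matrix.fromBlocks p 0 0 q) 0 0 r) :=
    (MvN.dsum_blocks hpq hr).trans (isStarProjection_dsum hpq hr) b1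
      ((MvN.dsum_blocks hp hq).blocks (MvN.refl hr))
  have h2 : MvN (dsum p (dsum q r)) (Matrix.fromBlocks p 0 0 (Matrix.fromBlocks q 0 0 r)) :=
    (MvN.dsum_blocks hp hqr).trans (isStarProjection_dsum hp hqr) b2
      ((MvN.refl hp).blocks (MvN.dsum_blocks hq hr))
  have h := MvN.reindex b1 (Equiv.sumAssoc _ _ _)
  have e : Matrix.reindex (Equiv.sumAssoc (Fin l) (Fin m) (Fin n))
      (Equiv.sumAssoc (Fin l) (Fin m) (Fin n))
      (Matrix.fromBlocks (Matrix.fromBlocks p 0 0 q) 0 0 r) =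
      Matrix.fromBlocks p 0 0 (Matrix.fromBlocks q 0 0 r) := by
    ext (i | i | i) (j | j | j) <;> rfl
  rw [e] at h
  have d1 := isStarProjection_dsum hpq hr
  exact (h1.trans d1 b2 h).trans d1 (isStarProjection_dsum hp hqr) h2.symm

instance : AddCommMonoid (V A) where
  add_assoc := add_assoc'
  zero_add := zero_add'
  add_zero x := by rw [add_comm', zero_add']
  add_comm := add_comm'
  nsmul := nsmulRec

end V

variable {B : Type*} [CStarAlgebra B]

/-- Entrywise application of a unital `*`-homomorphism to square matrices. -/
def matMap (φ : A →⋆ₐ[ℂ] B) (n : ℕ) :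
    Matrix (Fin n) (Fin n) A →⋆* Matrix (Fin n) (Fin n) B where
  toFun M := M.map φ
  map_one' := by simp [Matrix.map_one]
  map_mul' M N := Matrix.map_mul (f := φ)
  map_star' M := by ext i j; simp [Matrix.star_apply, map_star]

lemma isStarProjection_map (φ : A →⋆ₐ[ℂ] B) {n : ℕ} {p : Matrix (Fin n) (Fin n) A}
    (hp : IsStarProjection p) : IsStarProjection (p.map φ) :=
  hp.map (matMap φ n)

lemma MvN.map (φ : A →⋆ₐ[ℂ] B) {m n : ℕ} {p : Matrix (Fin m) (Fin m) A}
    {q : Matrix (Fin n) (Fin n) A} (h : MvN p q) : MvN (p.map φ) (q.map φ) := by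
  obtain ⟨v, rfl, rfl⟩ := h
  have e : (v.map φ)ᴴ = vᴴ.map φ := by ext i j; simp [map_star]
  exact ⟨v.map φ, by rw [e, Matrix.map_mul], by rw [e, Matrix.map_mul]⟩

/-- The map `V(A) → V(B)`, `[p] ↦ [φ(p)]`. -/
def V.map (φ : A →⋆ₐ[ℂ] B) : V A →+ V B where
  toFun := Quotient.map (fun p => ⟨p.1, p.2.1.map φ, isStarProjection_map φ p.2.2⟩)
    (fun _ _ h => MvN.map φ h)
  map_zero' := by
    change V.mk _ _ = V.mk _ _
    congr 1
    ext i j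
    exact i.elim0
  map_add' x y := by
    induction x using V.ind with | _ m p hp
    induction y using V.ind with | _ n q hq
    change V.mk ((dsum p q).map φ) (isStarProjection_map φ (isStarProjection_dsum hp hq)) =
      V.mk (dsum (p.map φ) (q.map φ)) _
    congr 1
    simp only [dsum, Matrix.reindex_apply, ← Matrix.submatrix_map, Matrix.fromBlocks_map,
      Matrix.map_zero _ (map_zero φ)]

end Projections

/-- `K₀(A)`: the Grothendieck group of `V(A)`, for a unital C⋆-algebra `A`. -/
abbrev K0 (A : Type*) [CStarAlgebra A] : Type _ := Algebra.GrothendieckAddGroup (V A)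

/-- The homomorphism `K₀(φ) : K₀(A) → K₀(B)`, `[p] - [q] ↦ [φ(p)] - [φ(q)]`. -/
def K0.map {A B : Type*} [CStarAlgebra A] [CStarAlgebra B] (φ : A →⋆ₐ[ℂ] B) : K0 A →+ K0 B :=
  Algebra.GrothendieckAddGroup.lift (Algebra.GrothendieckAddGroup.of.comp (V.map φ))

/-! ### Unitaries and `K₁` -/

section Unitaries

variable {A : Type*} [CStarAlgebra A]

variable (A) in
/-- The unitary group `U_n(A)` of `M_n(A)`. It carries the topology of entrywise norm convergence,
which is the topology of the C⋆-norm on `M_n(A)`. -/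
abbrev U (n : ℕ) : Type _ := unitary (Matrix (Fin n) (Fin n) A)

/-- The embedding `u ↦ diag(u, 1)` on matrices. -/
def extMat {n m : ℕ} (M : Matrix (Fin n) (Fin n) A) : Matrix (Fin m) (Fin m) A := fun i j =>
  if hi : i.1 < n then (if hj : j.1 < n then M ⟨i, hi⟩ ⟨j, hj⟩ else 0)
  else if i = j then 1 else 0

lemma extMat_eq_dsum {n k : ℕ} (M : Matrix (Fin n) (Fin n) A) :
    extMat (m := n + k) M = dsum M 1 := by
  ext i j
  refine Fin.addCases (fun i => ?_) (fun i => ?_) i <;>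
  refine Fin.addCases (fun j => ?_) (fun j => ?_) j <;>
  simp [extMat, dsum, Matrix.one_apply, Fin.ext_iff]
  intro h
  omega

lemma dsum_mul_dsum {m n : ℕ} (p p' : Matrix (Fin m) (Fin m) A) (q q' : Matrix (Fin n) (Fin n) A) :
    dsum p q * dsum p' q' = dsum (p * p') (q * q') := by
  simp only [dsum, Matrix.reindex_apply]
  rw [Matrix.submatrix_mul_equiv, Matrix.fromBlocks_multiply]
  simp

lemma star_dsum {m n : ℕ} (p : Matrix (Fin m) (Fin m) A) (q : Matrix (Fin n) (Fin n) A) :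
    star (dsum p q) = dsum (star p) (star q) := by
  simp only [dsum, Matrix.star_eq_conjTranspose, Matrix.conjTranspose_reindex,
    Matrix.fromBlocks_conjTranspose, Matrix.conjTranspose_zero]

lemma dsum_one_one {m n : ℕ} :
    dsum (1 : Matrix (Fin m) (Fin m) A) (1 : Matrix (Fin n) (Fin n) A) = 1 := by
  simp [dsum, Matrix.fromBlocks_one]

/-- The embedding `u ↦ diag(u, 1)` of `M_n(A)` into `M_m(A)`, for `n ≤ m`, as a homomorphism of
multiplicative monoids with involution. -/
def extHom {n m : ℕ} (h : n ≤ m) :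
    Matrix (Fin n) (Fin n) A →⋆* Matrix (Fin m) (Fin m) A where
  toFun := extMat
  map_one' := by
    obtain ⟨k, rfl⟩ := Nat.exists_eq_add_of_le h
    rw [extMat_eq_dsum, dsum_one_one]
  map_mul' M N := by
    obtain ⟨k, rfl⟩ := Nat.exists_eq_add_of_le h
    simp [extMat_eq_dsum, dsum_mul_dsum]
  map_star' M := by
    obtain ⟨k, rfl⟩ := Nat.exists_eq_add_of_le h
    simp [extMat_eq_dsum, star_dsum]

variable (A) in
/-- The embedding `U_n(A) → U_m(A)`, `u ↦ diag(u, 1)`, for `n ≤ m`. -/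
def stab (n m : ℕ) (h : n ≤ m) : U A n →* U A m := (Unitary.map (extHom h)).toMonoidHom

lemma coe_stab {n m : ℕ} (h : n ≤ m) (u : U A n) :
    (stab A n m h u : Matrix (Fin m) (Fin m) A) = extMat u.1 := rfl

lemma continuous_stab {n m : ℕ} (h : n ≤ m) : Continuous (stab A n m h) := by
  refine Continuous.subtype_mk ?_ _
  change Continuous fun u : U A n => (extMat u.1 : Matrix (Fin m) (Fin m) A)
  refine continuous_matrix fun i j => ?_
  simp only [extMat]
  split_ifs
  · exact continuous_subtype_val.matrix_elem _ _
  all_goals exact continuous_const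

instance : DirectedSystem (U A) (fun n m h => stab A n m h) where
  map_self n u := by
    apply Subtype.ext
    rw [coe_stab]
    ext i j
    simp [extMat]
  map_map k j i hij hjk u := by
    apply Subtype.ext
    simp only [coe_stab]
    ext a b
    simp only [extMat, Fin.ext_iff]
    split_ifs <;> first | rfl | omega

variable (A) in
/-- The group `U_∞(A) = ⋃ U_n(A)`, the direct limit along the embeddings `u ↦ diag(u, 1)`. -/
abbrev Uinf : Type _ := DirectLimit (U A) (stab A)

/-- The class in `U_∞(A)` of a unitary in `U_n(A)`. -/
def Uinf.mk {n : ℕ} (u : U A n) : Uinf A := ⟦⟨n, u⟩⟧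

lemma Uinf.mk_stab {n m : ℕ} (h : n ≤ m) (u : U A n) : Uinf.mk (stab A n m h u) = Uinf.mk u :=
  DirectLimit.mk_apply _ _ _ _

lemma Uinf.mk_mul {n : ℕ} (u v : U A n) : Uinf.mk u * Uinf.mk v = Uinf.mk (u * v) :=
  DirectLimit.mul_def _ _ _

lemma Uinf.mk_inv {n : ℕ} (u : U A n) : (Uinf.mk u)⁻¹ = Uinf.mk u⁻¹ := rfl

lemma Uinf.exists_mk (x : Uinf A) : ∃ (n : ℕ) (u : U A n), x = Uinf.mk u :=
  DirectLimit.exists_eq_mk _ x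

lemma Uinf.exists_mk₂ (x y : Uinf A) :
    ∃ (n : ℕ) (u v : U A n), x = Uinf.mk u ∧ y = Uinf.mk v :=
  DirectLimit.exists_eq_mk₂ _ x y

lemma joined_one_mul {n : ℕ} {u v : U A n} (hu : Joined 1 u) (hv : Joined 1 v) :
    Joined 1 (u * v) := by
  simpa using hu.mul hv

lemma joined_one_stab {n m : ℕ} (h : n ≤ m) {u : U A n} (hu : Joined 1 u) :
    Joined 1 (stab A n m h u) := by
  simpa using hu.map (continuous_stab h)

variable (A) in
/-- The subgroup `U_∞(A)₀` of those elements that are connected to `1` by a path in some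
`U_n(A)`. -/
def Uinf0 : Subgroup (Uinf A) where
  carrier := {x | ∃ (n : ℕ) (u : U A n), Joined 1 u ∧ Uinf.mk u = x}
  one_mem' := ⟨0, 1, Joined.refl _, (DirectLimit.one_def 0).symm⟩
  mul_mem' := by
    rintro _ _ ⟨n, u, hu, rfl⟩ ⟨m, v, hv, rfl⟩
    refine ⟨max n m, _, joined_one_mul (joined_one_stab (le_max_left n m) hu)
      (joined_one_stab (le_max_right n m) hv), ?_⟩
    rw [← Uinf.mk_mul, Uinf.mk_stab, Uinf.mk_stab]
  inv_mem' := by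
    rintro _ ⟨n, u, hu, rfl⟩
    exact ⟨n, u⁻¹, by simpa using hu.inv, (Uinf.mk_inv u).symm⟩

/-- The rotation matrix `((cos t, -sin t), (sin t, cos t))` with scalar blocks of size `n`. -/
def rot (n : ℕ) (t : ℝ) : Matrix (Fin (n + n)) (Fin (n + n)) A :=
  Matrix.reindex finSumFinEquiv finSumFinEquiv
    (Matrix.fromBlocks ((Real.cos t : ℂ) • 1) (-((Real.sin t : ℂ) • 1))
      ((Real.sin t : ℂ) • 1) ((Real.cos t : ℂ) • 1))

lemma star_rot (n : ℕ) (t : ℝ) : star (rot n t : Matrix _ _ A) = rot n (-t) := by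
  simp only [rot, Matrix.star_eq_conjTranspose, Matrix.conjTranspose_reindex,
    Matrix.fromBlocks_conjTranspose]
  simp [Matrix.conjTranspose_smul, -Complex.ofReal_cos, -Complex.ofReal_sin]

lemma rot_mul_rot (n : ℕ) (s t : ℝ) : (rot n s * rot n t : Matrix _ _ A) = rot n (s + t) := by
  simp only [rot, Matrix.reindex_apply]
  rw [Matrix.submatrix_mul_equiv, Matrix.fromBlocks_multiply]
  congr 2 <;>
  simp [Real.cos_add, Real.sin_add, smul_smul, add_smul, sub_smul, mul_comm] <;> abel

lemma rot_zero (n : ℕ) : (rot n 0 : Matrix _ _ A) = 1 := by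
  simp [rot, Matrix.fromBlocks_one]

variable (A) in
/-- The rotation as a unitary. -/
def rotU (n : ℕ) (t : ℝ) : U A (n + n) :=
  ⟨rot n t, Unitary.mem_iff.2 ⟨by simp [star_rot, rot_mul_rot, rot_zero],
    by simp [star_rot, rot_mul_rot, rot_zero]⟩⟩

lemma continuous_rotU (n : ℕ) : Continuous (rotU A n) := by
  refine Continuous.subtype_mk ?_ _
  refine Continuous.matrix_reindex ?_ _ _
  refine Continuous.matrix_fromBlocks ?_ ?_ ?_ ?_ <;> fun_prop

lemma rotU_zero (n : ℕ) : rotU A n 0 = 1 := Subtype.ext (rot_zero n)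

lemma rotU_conj (n : ℕ) (v : U A n) :
    (rotU A n (Real.pi / 2) * stab A n (n + n) (Nat.le_add_right n n) v *
      (rotU A n (Real.pi / 2))⁻¹).1 = dsum 1 v.1 := by
  change rot n (Real.pi / 2) * extMat v.1 * star (rot n (Real.pi / 2)) = _
  rw [star_rot, extMat_eq_dsum]
  simp only [rot, dsum, Matrix.reindex_apply]
  rw [Matrix.submatrix_mul_equiv, Matrix.submatrix_mul_equiv, Matrix.fromBlocks_multiply,
    Matrix.fromBlocks_multiply]
  simp

/-- Commutators in `U_n(A)` become homotopic to `1` in `U_{2n}(A)`. -/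
lemma joined_commutator (n : ℕ) (u v : U A n) :
    Joined 1 (stab A n (n + n) (Nat.le_add_right n n) (u * v * u⁻¹ * v⁻¹)) := by
  set S := stab A n (n + n) (Nat.le_add_right n n) with hS
  let w : ℝ → U A (n + n) := fun t =>
    S u * (rotU A n t * S v * (rotU A n t)⁻¹) * (S u)⁻¹ * (rotU A n t * S v * (rotU A n t)⁻¹)⁻¹
  have hw : Continuous w := by
    have := continuous_rotU (A := A) n
    fun_prop
  have h0 : w 0 = S (u * v * u⁻¹ * v⁻¹) := by simp [w, rotU_zero]
  have h1 : w (Real.pi / 2) = 1 := by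
    have hc : S u * (rotU A n (Real.pi / 2) * S v * (rotU A n (Real.pi / 2))⁻¹) =
        (rotU A n (Real.pi / 2) * S v * (rotU A n (Real.pi / 2))⁻¹) * S u := by
      apply Subtype.ext
      have e1 : (S u).1 = dsum u.1 1 := by rw [hS, coe_stab, extMat_eq_dsum]
      have e2 := rotU_conj n v
      rw [← hS] at e2
      rw [Submonoid.coe_mul (unitary _) (S u), Submonoid.coe_mul (unitary _) _ (S u), e1, e2,
        dsum_mul_dsum, dsum_mul_dsum]
      simp
    simp only [w]
    rw [hc]
    group
  have hj : Joined (w (Real.pi / 2)) (w 0) := by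
    have := (PathConnectedSpace.joined (Real.pi / 2) (0 : ℝ)).map hw
    exact this
  rwa [h0, h1] at hj

lemma commutator_mem (x y : Uinf A) : x * y * x⁻¹ * y⁻¹ ∈ Uinf0 A := by
  obtain ⟨n, u, v, rfl, rfl⟩ := Uinf.exists_mk₂ x y
  refine ⟨n + n, _, joined_commutator n u v, ?_⟩
  rw [Uinf.mk_stab]
  simp only [Uinf.mk_inv, Uinf.mk_mul]

instance : (Uinf0 A).Normal where
  conj_mem x hx g := by
    have h := (Uinf0 A).mul_mem (commutator_mem g x) hx
    simpa using h

instance : CommGroup (Uinf A ⧸ Uinf0 A) where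
  mul_comm := by
    rintro ⟨x⟩ ⟨y⟩
    change (QuotientGroup.mk (x * y) : Uinf A ⧸ Uinf0 A) = QuotientGroup.mk (y * x)
    rw [QuotientGroup.eq]
    have := commutator_mem y⁻¹ x⁻¹
    simpa [mul_assoc] using this

end Unitaries

/-- `K₁(A) = U_∞(A) / U_∞(A)₀`, written additively, for a unital C⋆-algebra `A`. -/
abbrev K1 (A : Type*) [CStarAlgebra A] : Type _ := Additive (Uinf A ⧸ Uinf0 A)

section Map

variable {A B : Type*} [CStarAlgebra A] [CStarAlgebra B]

/-- Entrywise application of a unital `*`-homomorphism, `U_n(A) → U_n(B)`. -/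
def uMap (φ : A →⋆ₐ[ℂ] B) (n : ℕ) : U A n →* U B n := (Unitary.map (matMap φ n)).toMonoidHom

lemma coe_uMap (φ : A →⋆ₐ[ℂ] B) {n : ℕ} (u : U A n) :
    (uMap φ n u : Matrix (Fin n) (Fin n) B) = u.1.map φ := rfl

lemma continuous_uMap (φ : A →⋆ₐ[ℂ] B) (n : ℕ) : Continuous (uMap φ n) := by
  refine Continuous.subtype_mk ?_ _
  change Continuous fun u : U A n => u.1.map φ
  exact continuous_subtype_val.matrix_map (map_continuous φ)

lemma uMap_stab (φ : A →⋆ₐ[ℂ] B) {n m : ℕ} (h : n ≤ m) (u : U A n) :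
    uMap φ m (stab A n m h u) = stab B n m h (uMap φ n u) := by
  apply Subtype.ext
  rw [coe_uMap, coe_stab, coe_stab, coe_uMap]
  ext i j
  simp only [extMat, Matrix.map_apply]
  split_ifs <;> simp

/-- The homomorphism `U_∞(A) → U_∞(B)` induced by a unital `*`-homomorphism. -/
def Uinf.map (φ : A →⋆ₐ[ℂ] B) : Uinf A →* Uinf B where
  toFun := DirectLimit.map (stab A) (stab B) (fun n u => uMap φ n u)
    (fun _ _ h u => (uMap_stab φ h u).symm)
  map_one' := by
    rw [DirectLimit.one_def 0, DirectLimit.one_def 0, DirectLimit.map_def]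
    simp
  map_mul' x y := by
    obtain ⟨n, u, v, rfl, rfl⟩ := Uinf.exists_mk₂ x y
    rw [Uinf.mk_mul]
    simp only [Uinf.mk, DirectLimit.map_def, map_mul]
    exact (DirectLimit.mul_def _ _ _).symm

lemma Uinf.map_mk (φ : A →⋆ₐ[ℂ] B) {n : ℕ} (u : U A n) :
    Uinf.map φ (Uinf.mk u) = Uinf.mk (uMap φ n u) := rfl

lemma Uinf0_le_comap (φ : A →⋆ₐ[ℂ] B) : Uinf0 A ≤ (Uinf0 B).comap (Uinf.map φ) := by
  rintro _ ⟨n, u, hu, rfl⟩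
  exact ⟨n, uMap φ n u, by simpa using hu.map (continuous_uMap φ n), (Uinf.map_mk φ u).symm⟩

/-- The homomorphism `K₁(φ) : K₁(A) → K₁(B)`, `[u] ↦ [φ(u)]`. -/
def K1.map (φ : A →⋆ₐ[ℂ] B) : K1 A →+ K1 B :=
  (QuotientGroup.map (Uinf0 A) (Uinf0 B) (Uinf.map φ) (Uinf0_le_comap φ)).toAdditive

end Map

end CStarK

/-! ### Circle actions -/

section Actions

variable {A : Type*} [CStarAlgebra A]

/-- The fixed point algebra `A^α`. -/
def fixedPointAlgebra (α : Circle →* (A ≃⋆ₐ[ℂ] A)) : StarSubalgebra ℂ A where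
  carrier := {a | ∀ ζ : Circle, α ζ a = a}
  mul_mem' ha hb ζ := by rw [map_mul, ha ζ, hb ζ]
  add_mem' ha hb ζ := by rw [map_add, ha ζ, hb ζ]
  algebraMap_mem' r ζ := by
    rw [Algebra.algebraMap_eq_smul_one, map_smul, map_one]
  star_mem' ha ζ := by rw [map_star, ha ζ]

instance fixedPointAlgebra.isClosed (α : Circle →* (A ≃⋆ₐ[ℂ] A)) :
    IsClosed (fixedPointAlgebra α : Set A) := by
  have : (fixedPointAlgebra α : Set A) = ⋂ ζ : Circle, {a | α ζ a = a} := by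
    ext a
    simp only [Set.mem_iInter, Set.mem_ofPred_eq]
    rfl
  rw [this]
  exact isClosed_iInter fun ζ =>
    isClosed_eq (NonUnitalStarAlgHom.isometry (α ζ) (α ζ).injective).continuous continuous_id

/-- The Rokhlin property of a circle action. -/
def HasRokhlinProperty (α : Circle →* (A ≃⋆ₐ[ℂ] A)) : Prop :=
  ∀ ε : ℝ, 0 < ε → ∀ F : Finset A, ∃ u ∈ unitary A,
    (∀ ζ : Circle, ‖α ζ u - (ζ : ℂ) • u‖ < ε) ∧ ∀ a ∈ F, ‖u * a - a * u‖ < ε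

end Actions

/-- A subgroup `H` of an abelian group `G` is pure if every torsion element of `G / H` lifts to a
torsion element of `G` of the same order. -/
def AddSubgroup.IsPure {G : Type*} [AddCommGroup G] (H : AddSubgroup G) : Prop :=
  ∀ x : G ⧸ H, IsOfFinAddOrder x →
    ∃ g : G, (QuotientAddGroup.mk g : G ⧸ H) = x ∧ IsOfFinAddOrder g ∧
      addOrderOf g = addOrderOf x

end

noncomputable section

/-! The fixed point algebra is an asymptotic retract of `A`. Averaging over the circle replaces each
Rokhlin unitary by a nearby unitary `u` with `α_ζ(u) = ζu` exactly
(`HasRokhlinProperty.exists_unitary_mem_spectralSubspace`). On an element `a` of spectral degree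
`n`, the map `a ↦ u⁻ⁿ a` lands in the fixed point algebra. It is multiplicative up to commutators of
powers of `u` with `a`, and it is the identity in degree zero. It need not be bounded on sums of
different degrees, so it is replaced by `rokhlinMap`: compress `a` by `∑_{k<N} u*ᵏ`, average over
the circle and divide by `N`. This map is positive, hence bounded uniformly in `u` and `N`, and on
degree `n` it is close to `((N - |n|)/N) u⁻ⁿ a`. Letting `u` become central first and then `N → ∞`,
and using that the spectral subspaces span a dense subspace, gives
`HasRokhlinProperty.exists_asympRetract`.

For K-theory, images of projections, partial isometries and unitaries under such maps almost satisfy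
the defining relations and can be corrected to exact ones. Hence an equation over `A` whose
constants come from `B` can be solved over `B` at some index. Applied to `k • g = K_j(φ)(b)`, this
yields `b'` with `k • b' = b` (`AsympRetract.exists_nsmul_K0`, `AsympRetract.exists_nsmul_K1`).

All three conclusions follow from this divisibility property by algebra. The case `k = 0` is
injectivity. For general `k`, a torsion class of the quotient lifts with the same order, which is
purity. If the ambient group is finitely generated, the quotient is a direct sum of cyclic groups,
so lifting generators with their orders gives a section, and hence a retraction. -/

namespace CStarK

/-! ### Perturbation of almost unitaries, almost projections and almost partial isometries. -/

section Perturbation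

variable {M : Type*} [CStarAlgebra M]

/-- The inverse square root `b ^ (-1/2)`, by continuous functional calculus. -/
def invSqrt (b : M) : M := cfc (fun t : ℝ => (√t)⁻¹) b

lemma isSelfAdjoint_invSqrt (b : M) : IsSelfAdjoint (invSqrt b) := cfc_predicate _ b

lemma commute_invSqrt {b c : M} (h : Commute b c) : Commute (invSqrt b) c := h.cfc_real _

lemma abs_sub_one_le_of_mem_spectrum {b : M} {t : ℝ} (ht : t ∈ spectrum ℝ b) :
    |t - 1| ≤ ‖b - 1‖ := by
  rcases subsingleton_or_nontrivial M with hM | hM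
  · simp [spectrum.of_subsingleton] at ht
  have h : t - 1 ∈ spectrum ℝ (b - 1) := by
    have := (spectrum.sub_singleton_eq b (1 : ℝ)).le (Set.sub_mem_sub ht (Set.mem_singleton 1))
    simpa using this
  simpa using spectrum.norm_le_norm_of_mem h

lemma half_le_of_mem_spectrum {b : M} (h : ‖b - 1‖ ≤ 1 / 2) {t : ℝ} (ht : t ∈ spectrum ℝ b) :
    1 / 2 ≤ t := by
  have := (abs_le.1 ((abs_sub_one_le_of_mem_spectrum ht).trans h)).1
  linarith

lemma continuousOn_inv_sqrt_spectrum {b : M} (h : ‖b - 1‖ ≤ 1 / 2) :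
    ContinuousOn (fun t : ℝ => (√t)⁻¹) (spectrum ℝ b) :=
  Real.continuous_sqrt.continuousOn.inv₀ fun t ht =>
    (Real.sqrt_pos.2 (by linarith [half_le_of_mem_spectrum h ht])).ne'

lemma invSqrt_mul_self_mul {b : M} (hb : IsSelfAdjoint b) (h : ‖b - 1‖ ≤ 1 / 2) :
    invSqrt b * invSqrt b * b = 1 := by
  have hc := continuousOn_inv_sqrt_spectrum h
  rw [invSqrt, ← cfc_mul _ _ b hc hc]
  calc cfc (fun t : ℝ => (√t)⁻¹ * (√t)⁻¹) b * b
      = cfc (fun t : ℝ => (√t)⁻¹ * (√t)⁻¹) b * cfc (fun t : ℝ => t) b := by rw [cfc_id' ℝ b]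
    _ = cfc (fun t : ℝ => (√t)⁻¹ * (√t)⁻¹ * t) b :=
        (cfc_mul _ _ b (hc.mul hc) continuousOn_id).symm
    _ = cfc (1 : ℝ → ℝ) b := cfc_congr fun t ht => ?_
    _ = 1 := cfc_one ℝ b
  have ht' := half_le_of_mem_spectrum h ht
  have : √t * √t = t := Real.mul_self_sqrt (by linarith)
  have h0 : t ≠ 0 := by linarith
  simp only [Pi.one_apply]
  rw [← mul_inv, this, inv_mul_cancel₀ h0]

lemma norm_invSqrt_sub_one_le {b : M} (hb : IsSelfAdjoint b) (h : ‖b - 1‖ ≤ 1 / 2) :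
    ‖invSqrt b - 1‖ ≤ ‖b - 1‖ := by
  have hc := continuousOn_inv_sqrt_spectrum h
  have e : invSqrt b - 1 = cfc (fun t : ℝ => (√t)⁻¹ - 1) b := by
    rw [cfc_sub _ _ b hc continuousOn_const, cfc_const_one ℝ b, invSqrt]
  rw [e]
  refine norm_cfc_le (norm_nonneg _) fun t ht => ?_
  refine le_trans ?_ (abs_sub_one_le_of_mem_spectrum ht)
  have ht' := half_le_of_mem_spectrum h ht
  have h2 : √t * √t = t := Real.mul_self_sqrt (by linarith)
  -- With `t ≥ 1/2` this gives `√t (√t + 1) = t + √t ≥ 1`, that is, `1/√t ≤ √t + 1`.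
  have h3 : 1 / 2 ≤ √t := Real.le_sqrt_of_sq_le (by linarith)
  have h4 : t - 1 = (√t - 1) * (√t + 1) := by linear_combination -h2
  have h5 : (√t)⁻¹ - 1 = -(√t - 1) * (√t)⁻¹ := by
    field_simp
    ring
  simp only [Real.norm_eq_abs]
  rw [h4, h5, abs_mul, abs_mul, abs_neg]
  refine mul_le_mul_of_nonneg_left ?_ (abs_nonneg _)
  rw [abs_of_nonneg (by positivity), abs_of_nonneg (by positivity),
    inv_le_iff_one_le_mul₀' (by linarith)]
  nlinarith

/-- The unitary part in the polar decomposition of an almost unitary element. -/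
def polar (x : M) : M := x * invSqrt (star x * x)

lemma star_polar_mul_polar {x : M} (h : ‖star x * x - 1‖ ≤ 1 / 2) :
    star (polar x) * polar x = 1 := by
  have hb : IsSelfAdjoint (star x * x) := .star_mul_self x
  have hc : Commute (invSqrt (star x * x)) (star x * x) := commute_invSqrt (Commute.refl _)
  have h1 := invSqrt_mul_self_mul hb h
  rw [mul_assoc, hc.eq] at h1
  rw [polar, star_mul, (isSelfAdjoint_invSqrt _).star_eq]
  simpa only [mul_assoc] using h1

/-- With `y = (x*x)^(-1/2)`, the element `y²x*` is a left inverse of `x`. Invertibility of `xx*`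
provides a right inverse; the two coincide, so `x y² x* = 1`. -/
lemma polar_mem_unitary {x : M} (h : ‖star x * x - 1‖ ≤ 1 / 2) (h' : ‖x * star x - 1‖ < 1) :
    polar x ∈ unitary M := by
  refine Unitary.mem_iff.2 ⟨star_polar_mul_polar h, ?_⟩
  have hb : IsSelfAdjoint (star x * x) := .star_mul_self x
  set y := invSqrt (star x * x) with hy
  have h1 : y * y * star x * x = 1 := by
    rw [mul_assoc _ (star x)]; exact invSqrt_mul_self_mul hb h
  have hu : IsUnit (x * star x) := by
    have := isUnit_one_sub_of_norm_lt_one (x := 1 - x * star x) (by rwa [norm_sub_rev])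
    simpa using this
  obtain ⟨c, hc⟩ := hu.exists_right_inv
  rw [mul_assoc] at hc
  have h2 := left_inv_eq_right_inv h1 hc
  rw [← h2] at hc
  rw [polar, star_mul, (isSelfAdjoint_invSqrt _).star_eq, ← hy]
  simpa only [mul_assoc] using hc

lemma norm_le_two_of_star_mul_self {x : M} (h : ‖star x * x - 1‖ ≤ 1 / 2) : ‖x‖ ≤ 2 := by
  nontriviality M
  have h1 : ‖star x * x‖ ≤ 3 / 2 := by
    calc ‖star x * x‖ = ‖(star x * x - 1) + 1‖ := by simp
      _ ≤ ‖star x * x - 1‖ + ‖(1 : M)‖ := norm_add_le _ _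
      _ ≤ 3 / 2 := by rw [CStarRing.norm_one]; linarith
  rw [CStarRing.norm_star_mul_self] at h1
  nlinarith [norm_nonneg x]

lemma norm_polar_sub_le {x : M} (h : ‖star x * x - 1‖ ≤ 1 / 2) :
    ‖polar x - x‖ ≤ 2 * ‖star x * x - 1‖ := by
  have e : polar x - x = x * (invSqrt (star x * x) - 1) := by rw [polar, mul_sub, mul_one]
  rw [e]
  exact (norm_mul_le _ _).trans (mul_le_mul (norm_le_two_of_star_mul_self h)
    (norm_invSqrt_sub_one_le (.star_mul_self x) h) (norm_nonneg _) zero_le_two)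

/-- An almost idempotent selfadjoint element is close to a projection. -/
lemma exists_isStarProjection_near {p : M} (hp : IsSelfAdjoint p) (h : ‖p * p - p‖ ≤ 1 / 8) :
    ∃ q : M, IsStarProjection q ∧ ‖q - p‖ ≤ 4 * ‖p * p - p‖ := by
  -- Projections correspond to selfadjoint unitaries through `p ↦ 2p - 1`. Since `s² - 1 = 4(p² -
  -- p)`, the bound `1/8` is what makes the polar part of `s` available, and that part stays
  -- selfadjoint because `s` commutes with `s*s`.
  set s : M := (2 : ℂ) • p - 1 with hs
  have hss : star s = s := by
    rw [hs, star_sub, star_smul, hp.star_eq, star_one]; simp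
  have e : star s * s - 1 = (4 : ℂ) • (p * p - p) := by
    rw [hss, hs]
    simp only [sub_mul, mul_sub, smul_mul_assoc, mul_smul_comm, one_mul, mul_one, smul_sub,
      smul_smul]
    module
  have hn : ‖star s * s - 1‖ = 4 * ‖p * p - p‖ := by
    rw [e, norm_smul]; simp
  have h1 : ‖star s * s - 1‖ ≤ 1 / 2 := by rw [hn]; linarith
  have hc : Commute (invSqrt (star s * s)) s := by
    refine commute_invSqrt ?_
    rw [hss]
    exact (Commute.refl s).mul_left (Commute.refl s)
  have hsa : star (polar s) = polar s := by
    rw [polar, star_mul, (isSelfAdjoint_invSqrt _).star_eq, ← hc.eq]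
    rw [hss]
  have hi : polar s * polar s = 1 := by
    have := star_polar_mul_polar h1
    rwa [hsa] at this
  refine ⟨(1 / 2 : ℂ) • (1 + polar s), ⟨?_, ?_⟩, ?_⟩
  · change _ * _ = _
    simp only [add_mul, mul_add, smul_mul_assoc, mul_smul_comm, one_mul, mul_one, hi, smul_add,
      smul_smul]
    module
  · change star _ = _
    rw [star_smul, star_add, star_one, hsa]
    simp
  · have e2 : (1 / 2 : ℂ) • (1 + polar s) - p = (1 / 2 : ℂ) • (polar s - s) := by
      rw [hs]; module
    rw [e2, norm_smul]
    have := norm_polar_sub_le h1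
    rw [hn] at this
    have h3 : ‖(1 / 2 : ℂ)‖ = 1 / 2 := by simp
    rw [h3]
    linarith

/-- An element that almost implements an equivalence between two projections can be corrected to
a partial isometry. -/
lemma exists_partialIsometry {p q w : M} (hp : IsStarProjection p) (hq : IsStarProjection q)
    (hpw : p * w = w) (hwq : w * q = w) (h1 : ‖star w * w - q‖ ≤ 1 / 2)
    (h2 : ‖w * star w - p‖ < 1) : ∃ v : M, v * star v = p ∧ star v * v = q := by
  have hp2 : p * p = p := hp.isIdempotentElem
  have hq2 : q * q = q := hq.isIdempotentElem
  have hqw : q * star w = star w := by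
    simpa [hq.isSelfAdjoint.star_eq] using congrArg star hwq
  -- Adding `1 - q` makes `w*w` invertible in the whole algebra, so no corner is needed; `b` acts as
  -- the identity on `1 - q` and commutes with it.
  set b := star w * w + (1 - q) with hb
  have hbs : IsSelfAdjoint b :=
    (IsSelfAdjoint.star_mul_self w).add ((IsSelfAdjoint.one M).sub hq.isSelfAdjoint)
  have hb1 : ‖b - 1‖ ≤ 1 / 2 := by
    have : b - 1 = star w * w - q := by rw [hb]; abel
    rwa [this]
  have hbq : b * (1 - q) = 1 - q := by
    rw [hb, add_mul, mul_assoc, mul_sub w, hwq, mul_one, sub_self, mul_zero, zero_add, mul_sub,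
      sub_mul, sub_mul, hq2]
    simp
  have hqb : (1 - q) * b = 1 - q := by
    rw [hb, mul_add, ← mul_assoc, sub_mul 1 q (star w), hqw, one_mul, sub_self, zero_mul, zero_add,
      mul_sub, sub_mul, sub_mul, hq2]
    simp
  set y := invSqrt b with hy
  have hyy : y * y * b = 1 := invSqrt_mul_self_mul hbs hb1
  have hyb : y * b = b * y := (commute_invSqrt (Commute.refl b)).eq
  have hyq : y * (1 - q) = (1 - q) * y := (commute_invSqrt (hbq.trans hqb.symm)).eq
  have hys : star y = y := (isSelfAdjoint_invSqrt b).star_eq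
  have hyyq : y * y * (1 - q) = 1 - q := by
    calc y * y * (1 - q) = y * y * (b * (1 - q)) := by rw [hbq]
      _ = 1 - q := by rw [← mul_assoc, hyy, one_mul]
  -- The counterpart of `b` on the range side. From `cw = wb` one gets `w b⁻¹ w* = c⁻¹ w w* = c⁻¹(c
  -- - (1 - p)) = p`.
  set c := w * star w + (1 - p) with hc
  have hcu : IsUnit c := by
    have hn : ‖1 - c‖ < 1 := by
      have : 1 - c = -(w * star w - p) := by rw [hc]; abel
      rwa [this, norm_neg]
    simpa using isUnit_one_sub_of_norm_lt_one hn
  obtain ⟨d, hd⟩ := hcu.exists_left_inv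
  have hcp : c * (1 - p) = 1 - p := by
    have hwp : star w * p = star w := by
      simpa [hp.isSelfAdjoint.star_eq] using congrArg star hpw
    rw [hc, add_mul, mul_assoc, mul_sub (star w), hwp, mul_one, sub_self, mul_zero, zero_add,
      mul_sub, sub_mul, sub_mul, hp2]
    simp
  have hcw : c * w = w * b := by
    rw [hc, hb, add_mul, mul_add, sub_mul, mul_sub, hpw, hwq, mul_assoc]
    simp
  have hdw : d * w = w * (y * y) := by
    have hby : b * (y * y) = 1 := by
      rw [← mul_assoc, ← hyb, mul_assoc, ← hyb, ← mul_assoc, hyy]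
    calc d * w = d * (w * b) * (y * y) := by rw [mul_assoc, mul_assoc, hby, mul_one]
      _ = w * (y * y) := by rw [← hcw, ← mul_assoc d, hd, one_mul]
  refine ⟨w * y, ?_, ?_⟩
  · calc w * y * star (w * y) = w * (y * y) * star w := by
          rw [star_mul, hys]; simp only [mul_assoc]
      _ = d * (c - (1 - p)) := by rw [← hdw, hc, mul_assoc]; simp
      _ = d * c - d * (c * (1 - p)) := by rw [hcp, mul_sub]
      _ = p := by rw [← mul_assoc, hd]; simp
  · calc star (w * y) * (w * y) = y * (star w * w) * y := by
          rw [star_mul, hys]; simp only [mul_assoc]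
      _ = y * (b - (1 - q)) * y := by rw [hb]; simp
      _ = y * y * b - y * y * (1 - q) := by
          rw [mul_sub, sub_mul, mul_assoc y b y, ← hyb, hyq, mul_assoc (1 - q),
            mul_assoc y y (1 - q), hyq,
            ← mul_assoc y (1 - q), hyq]
          simp only [mul_assoc]
      _ = q := by rw [hyy, hyyq]; simp

end Perturbation

/-! ### Asymptotic retracts and lifting of relations along them. -/

open Filter Topology

/-- A family of uniformly bounded `*`-linear maps `ψ i : A → B` that is asymptotically
multiplicative along `l` and asymptotically a left inverse of `φ : B → A`. -/
structure AsympRetract {A B ι : Type*} [CStarAlgebra A] [CStarAlgebra B] (l : Filter ι)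
    (φ : B →⋆ₐ[ℂ] A) (ψ : ι → A →ₗ[ℂ] B) : Prop where
  apply_star : ∀ i a, ψ i (star a) = star (ψ i a)
  bound : ∃ C : ℝ, 0 ≤ C ∧ ∀ i a, ‖ψ i a‖ ≤ C * ‖a‖
  tendsto_mul : ∀ a b, Tendsto (fun i => ψ i (a * b) - ψ i a * ψ i b) l (𝓝 0)
  retract : ∀ b, Tendsto (fun i => ψ i (φ b)) l (𝓝 b)

/-- The family `f` of elements of `B` is asymptotic to the family `ψ i a`. -/
def Tracks {A B ι : Type*} [CStarAlgebra A] [CStarAlgebra B] (l : Filter ι)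
    (ψ : ι → A →ₗ[ℂ] B) (a : A) (f : ι → B) : Prop :=
  Tendsto (fun i => f i - ψ i a) l (𝓝 0)

section

variable {A B ι : Type*} [CStarAlgebra A] [CStarAlgebra B] {l : Filter ι} {φ : B →⋆ₐ[ℂ] A}
  {ψ : ι → A →ₗ[ℂ] B}

lemma Tracks.refl (a : A) : Tracks l ψ a (fun i => ψ i a) := by
  simpa [Tracks] using tendsto_const_nhds

lemma Tracks.tendsto_sub {a : A} {f g : ι → B} (hf : Tracks l ψ a f) (hg : Tracks l ψ a g) :
    Tendsto (fun i => f i - g i) l (𝓝 0) := by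
  simpa using hf.sub hg

lemma Tracks.sub {a b : A} {f g : ι → B} (hf : Tracks l ψ a f) (hg : Tracks l ψ b g) :
    Tracks l ψ (a - b) (fun i => f i - g i) := by
  have h := Filter.Tendsto.sub hf hg
  rw [sub_zero] at h
  refine h.congr fun i => ?_
  rw [map_sub, sub_sub_sub_comm]

lemma Tracks.of_near {a : A} {f g : ι → B} (hf : Tracks l ψ a f) {r : ι → ℝ} (C : ℝ)
    (hr : Tendsto r l (𝓝 0)) (h : ∀ᶠ i in l, ‖g i - f i‖ ≤ C * r i) : Tracks l ψ a g := by
  have h1 : Tendsto (fun i => g i - f i) l (𝓝 0) :=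
    squeeze_zero_norm' h (by simpa using hr.const_mul C)
  simpa [Tracks] using h1.add hf

namespace AsympRetract

variable (H : AsympRetract l φ ψ)
include H

lemma tracks_map (b : B) : Tracks l ψ (φ b) (fun _ => b) := by
  simpa [Tracks] using (tendsto_const_nhds (x := b)).sub (H.retract b)

lemma tracks_one : Tracks l ψ (1 : A) (fun _ => (1 : B)) := by
  simpa using H.tracks_map 1

lemma tracks_star {a : A} {f : ι → B} (hf : Tracks l ψ a f) :
    Tracks l ψ (star a) (fun i => star (f i)) := by
  have h := (continuous_star.tendsto (0 : B)).comp hf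
  rw [star_zero] at h
  refine h.congr fun i => ?_
  simp [H.apply_star]

lemma isBoundedUnder (a : A) : l.IsBoundedUnder (· ≤ ·) (norm ∘ fun i => ψ i a) := by
  obtain ⟨C, -, hC⟩ := H.bound
  exact isBoundedUnder_of ⟨C * ‖a‖, fun i => hC i a⟩

lemma tracks_isBoundedUnder {a : A} {f : ι → B} (hf : Tracks l ψ a f) :
    l.IsBoundedUnder (· ≤ ·) (norm ∘ f) := by
  obtain ⟨C, -, hC⟩ := H.bound
  refine ⟨1 + C * ‖a‖, ?_⟩
  rw [eventually_map]
  filter_upwards [hf.norm.eventually (gt_mem_nhds (by simp : ‖(0 : B)‖ < 1))] with i hi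
  calc ‖f i‖ = ‖(f i - ψ i a) + ψ i a‖ := by simp
    _ ≤ ‖f i - ψ i a‖ + ‖ψ i a‖ := norm_add_le _ _
    _ ≤ 1 + C * ‖a‖ := add_le_add hi.le (hC i a)

/-- The error splits into `(f - ψ a) ψ b`, `f (g - ψ b)` and the multiplicativity defect of `ψ`; the
first two vanish because the remaining factors are bounded. -/
lemma tracks_mul {a b : A} {f g : ι → B} (hf : Tracks l ψ a f) (hg : Tracks l ψ b g) :
    Tracks l ψ (a * b) (fun i => f i * g i) := by
  have h1 := hf.zero_mul_isBoundedUnder_le (H.isBoundedUnder b)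
  have h2 := isBoundedUnder_le_mul_tendsto_zero (H.tracks_isBoundedUnder hf) hg
  have h3 := (h1.add h2).sub (H.tendsto_mul a b)
  simp only [add_zero, sub_zero] at h3
  refine h3.congr fun i => ?_
  noncomm_ring

lemma tracks_pow {a : A} {f : ι → B} (hf : Tracks l ψ a f) (n : ℕ) :
    Tracks l ψ (a ^ n) (fun i => f i ^ n) := by
  induction n with
  | zero => simpa using H.tracks_one
  | succ n ih => simpa only [pow_succ] using H.tracks_mul ih hf

lemma tendsto_of_tracks_one {f : ι → B} (hf : Tracks l ψ (1 : A) f) : Tendsto f l (𝓝 1) := by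
  simpa using (hf.tendsto_sub H.tracks_one).add (tendsto_const_nhds (x := (1 : B)))

lemma exists_tracks_unitary (u : unitary A) :
    ∃ u' : ι → unitary B, Tracks l ψ (u : A) (fun i => (u' i : B)) := by
  classical
  let x : ι → B := fun i => ψ i (u : A)
  have hx : Tracks l ψ (u : A) x := Tracks.refl _
  have h1 : Tendsto (fun i => star (x i) * x i) l (𝓝 1) :=
    H.tendsto_of_tracks_one (by simpa using H.tracks_mul (H.tracks_star hx) hx)
  have h2 : Tendsto (fun i => x i * star (x i)) l (𝓝 1) :=
    H.tendsto_of_tracks_one (by simpa using H.tracks_mul hx (H.tracks_star hx))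
  have h1' := (tendsto_iff_norm_sub_tendsto_zero.1 h1)
  have h2' := (tendsto_iff_norm_sub_tendsto_zero.1 h2)
  -- The value `1` only fills the indices at which `ψ i u` is not yet almost unitary; asymptotically
  -- it is never used.
  refine ⟨fun i => if h : polar (x i) ∈ unitary B then ⟨polar (x i), h⟩ else 1, ?_⟩
  refine hx.of_near 2 h1' ?_
  filter_upwards [h1'.eventually (ge_mem_nhds (by norm_num : (0 : ℝ) < 1 / 2)),
    h2'.eventually (gt_mem_nhds one_pos)] with i hi1 hi2
  rw [dif_pos (polar_mem_unitary hi1 hi2)]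
  exact norm_polar_sub_le hi1

lemma exists_tracks_projection {p : A} (hp : IsStarProjection p) :
    ∃ p' : ι → B, (∀ i, IsStarProjection (p' i)) ∧ Tracks l ψ p p' := by
  classical
  let x : ι → B := fun i => ψ i p
  have hx : Tracks l ψ p x := Tracks.refl _
  have hxs : ∀ i, IsSelfAdjoint (x i) := fun i => by
    change star _ = _
    rw [← H.apply_star, hp.isSelfAdjoint.star_eq]
  have h1 : Tendsto (fun i => ‖x i * x i - x i‖) l (𝓝 0) := by
    have h : Tracks l ψ p (fun i => x i * x i) := by
      simpa only [hp.isIdempotentElem.eq] using H.tracks_mul hx hx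
    simpa using (h.tendsto_sub hx).norm
  have h2 : ∀ i, ∃ q : B, IsStarProjection q ∧
      (‖x i * x i - x i‖ ≤ 1 / 8 → ‖q - x i‖ ≤ 4 * ‖x i * x i - x i‖) := fun i => by
    by_cases hi : ‖x i * x i - x i‖ ≤ 1 / 8
    · obtain ⟨q, hq, hq'⟩ := exists_isStarProjection_near (hxs i) hi
      exact ⟨q, hq, fun _ => hq'⟩
    -- A filler for indices at which `ψ i p` is not almost idempotent.
    · exact ⟨0, IsStarProjection.zero _, fun h => (hi h).elim⟩
  choose q hq hq' using h2
  refine ⟨q, hq, hx.of_near 4 h1 ?_⟩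
  filter_upwards [h1.eventually (ge_mem_nhds (by norm_num : (0 : ℝ) < 1 / 8))] with i hi
  exact hq' i hi

/-- The family `ψ i v` is cut down by `p'` on the left and `q'` on the right, so that the support
relations hold exactly and only the norm estimates are asymptotic. -/
lemma eventually_exists_partialIsometry {p q v : A} (hp : IsStarProjection p)
    (hq : IsStarProjection q) (hvp : v * star v = p) (hvq : star v * v = q) {p' q' : ι → B}
    (hp' : ∀ i, IsStarProjection (p' i)) (hq' : ∀ i, IsStarProjection (q' i))
    (htp : Tracks l ψ p p') (htq : Tracks l ψ q q') :
    ∀ᶠ i in l, ∃ w : B, w * star w = p' i ∧ star w * w = q' i := by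
  let w : ι → B := fun i => p' i * ψ i v * q' i
  have hw : Tracks l ψ (p * v * q) w := H.tracks_mul (H.tracks_mul htp (Tracks.refl v)) htq
  have hpp : p * p = p := hp.isIdempotentElem
  have hqq : q * q = q := hq.isIdempotentElem
  have hps : star p = p := hp.isSelfAdjoint
  have hqs : star q = q := hq.isSelfAdjoint
  have e1 : star (p * v * q) * (p * v * q) = q := by
    calc star (p * v * q) * (p * v * q) = q * star v * (p * p) * v * q := by
          simp only [star_mul, hps, hqs, mul_assoc]
      _ = q * (star v * v) * (star v * v) * q := by rw [hpp, ← hvp]; simp only [mul_assoc]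
      _ = q := by rw [hvq]; simp only [hqq]
  have e2 : (p * v * q) * star (p * v * q) = p := by
    calc (p * v * q) * star (p * v * q) = p * v * (q * q) * star v * p := by
          simp only [star_mul, hps, hqs, mul_assoc]
      _ = p * (v * star v) * (v * star v) * p := by rw [hqq, ← hvq]; simp only [mul_assoc]
      _ = p := by rw [hvp]; simp only [hpp]
  have t1 := H.tracks_mul (H.tracks_star hw) hw
  have t2 := H.tracks_mul hw (H.tracks_star hw)
  rw [e1] at t1
  rw [e2] at t2
  have n1 := (t1.tendsto_sub htq).norm
  have n2 := (t2.tendsto_sub htp).norm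
  rw [norm_zero] at n1 n2
  filter_upwards [n1.eventually (ge_mem_nhds (by norm_num : (0 : ℝ) < 1 / 2)),
    n2.eventually (gt_mem_nhds one_pos)] with i hi1 hi2
  refine exists_partialIsometry (hp' i) (hq' i) ?_ ?_ hi1 hi2
  · simp only [w, ← mul_assoc, (hp' i).isIdempotentElem.eq]
  · simp only [w, mul_assoc, (hq' i).isIdempotentElem.eq]

/-- The unitaries of `A` all of whose asymptotic lifts are eventually homotopic to `1`. -/
def trivialLiftSubgroup : Subgroup (unitary A) where
  carrier := {z | ∀ z' : ι → unitary B, Tracks l ψ (z : A) (fun i => (z' i : B)) →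
    ∀ᶠ i in l, Joined 1 (z' i)}
  one_mem' := fun z' hz' => by
    have h := tendsto_iff_norm_sub_tendsto_zero.1 (H.tendsto_of_tracks_one (f := fun i => z' i) hz')
    filter_upwards [h.eventually (gt_mem_nhds two_pos)] with i hi
    exact Unitary.joined _ _ (by simpa using hi)
  -- Dividing a lift of `ab` by a lift of `a` leaves a lift of `b`.
  mul_mem' := fun {a b} ha hb z' hz' => by
    obtain ⟨u', hu'⟩ := H.exists_tracks_unitary a
    have h : Tracks l ψ (b : A) (fun i => (((u' i)⁻¹ * z' i : unitary B) : B)) := by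
      have := H.tracks_mul (H.tracks_star hu') hz'
      rw [Submonoid.coe_mul, ← mul_assoc, Unitary.coe_star_mul_self, one_mul] at this
      exact this
    filter_upwards [ha u' hu', hb _ h] with i h1 h2
    simpa using h1.mul h2
  inv_mem' := fun {a} ha z' hz' => by
    have h : Tracks l ψ (a : A) (fun i => (((z' i)⁻¹ : unitary B) : B)) := by
      have := H.tracks_star hz'
      rwa [show star ((a⁻¹ : unitary A) : A) = a from star_star _] at this
    filter_upwards [ha _ h] with i hi
    simpa using hi.inv

/-- Instead of lifting a path, one shows that the unitaries all of whose lifts are eventually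
trivial form a subgroup containing a neighbourhood of `1`. Such a subgroup is clopen, so it contains
the component of `1`. -/
lemma eventually_joined {z : unitary A} (hz : Joined 1 z) {z' : ι → unitary B}
    (ht : Tracks l ψ (z : A) (fun i => (z' i : B))) : ∀ᶠ i in l, Joined 1 (z' i) := by
  let G := H.trivialLiftSubgroup
  obtain ⟨C, hC0, hC⟩ := H.bound
  have hnhds : (G : Set (unitary A)) ∈ 𝓝 1 := by
    -- On this ball `‖ψ i (y - 1)‖ ≤ C‖y - 1‖ < 1`, so a lift that is within `1` of `ψ i (y - 1) +
    -- 1` has distance less than `2` from `1`, where unitaries are joined to `1`.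
    have hb : Metric.ball (1 : unitary A) (1 / (C + 1)) ∈ 𝓝 1 :=
      Metric.ball_mem_nhds _ (by positivity)
    refine mem_of_superset hb fun y hy y' hy' => ?_
    have hy1 : ‖(y : A) - 1‖ < 1 / (C + 1) := by
      simpa [Subtype.dist_eq, dist_eq_norm] using hy
    have ht1 := hy'.sub H.tracks_one
    filter_upwards [ht1.norm.eventually (gt_mem_nhds (by simp : ‖(0 : B)‖ < 1))] with i hi
    refine Unitary.joined _ _ ?_
    calc ‖(y' i : B) - ((1 : unitary B) : B)‖
        = ‖((y' i : B) - 1 - ψ i ((y : A) - 1)) + ψ i ((y : A) - 1)‖ := by simp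
      _ ≤ ‖(y' i : B) - 1 - ψ i ((y : A) - 1)‖ + ‖ψ i ((y : A) - 1)‖ := norm_add_le _ _
      _ < 1 + 1 := by
        refine add_lt_add hi ((hC i _).trans_lt ?_)
        have h2 : (C + 1) * ‖(y : A) - 1‖ < 1 := by
          have := mul_lt_mul_of_pos_left hy1 (by positivity : 0 < C + 1)
          rwa [mul_one_div_cancel (by positivity)] at this
        nlinarith [norm_nonneg ((y : A) - 1)]
      _ = 2 := by norm_num
  have hopen := G.isOpen_of_mem_nhds hnhds
  have hclopen : IsClopen (G : Set (unitary A)) := ⟨G.isClosed_of_isOpen hopen, hopen⟩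
  have hmem : z ∈ G := by
    refine hclopen.connectedComponent_subset G.one_mem ?_
    rw [← pathComponent_eq_connectedComponent]
    exact hz
  exact hmem z' ht

lemma exists_joined_pow [l.NeBot] {u : unitary A} {w : unitary B} {k : ℕ} {z : unitary A}
    (hz : (z : A) = (u : A) ^ k * star (φ (w : B))) (h : Joined 1 z) :
    ∃ u' : unitary B, Joined 1 (u' ^ k * w⁻¹) := by
  obtain ⟨u', hu'⟩ := H.exists_tracks_unitary u
  have ht : Tracks l ψ (z : A) (fun i => ((u' i ^ k * w⁻¹ : unitary B) : B)) := by
    rw [hz]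
    exact H.tracks_mul (H.tracks_pow hu' k) (H.tracks_star (H.tracks_map w))
  obtain ⟨i, hi⟩ := (H.eventually_joined h ht).exists
  exact ⟨u' i, hi⟩

end AsympRetract

end

/-! ### Passage to matrix algebras. -/

section MatrixRetract

/-- The topology of the C⋆-norm on matrices is by construction the product topology, so convergence
is entrywise. -/
lemma tendsto_cstarMatrix {A ι n : Type*} [CStarAlgebra A] {l : Filter ι}
    {f : ι → CStarMatrix n n A} {X : CStarMatrix n n A} :
    Tendsto f l (𝓝 X) ↔ ∀ i j, Tendsto (fun k => f k i j) l (𝓝 (X i j)) := by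
  have h : Tendsto f l (𝓝 X) ↔ Tendsto (fun k i j => f k i j) l (𝓝 fun i j => X i j) := Iff.rfl
  rw [h]
  simp only [tendsto_pi_nhds]

variable {A B ι : Type*} [CStarAlgebra A] [PartialOrder A] [StarOrderedRing A]
  [CStarAlgebra B] [PartialOrder B] [StarOrderedRing B] {n : Type*} [Fintype n] [DecidableEq n]

variable (n) in
/-- Entrywise application of a unital `*`-homomorphism to matrices, as a `*`-homomorphism of
C⋆-algebras. -/
def cmatMap (φ : B →⋆ₐ[ℂ] A) : CStarMatrix n n B →⋆ₐ[ℂ] CStarMatrix n n A where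
  toFun X := X.map φ
  map_one' := Matrix.map_one _ (map_zero φ) (map_one φ)
  map_mul' X Y := Matrix.map_mul (f := φ)
  map_zero' := Matrix.map_zero _ (map_zero φ)
  map_add' X Y := Matrix.map_add _ (map_add φ) X Y
  commutes' r := by
    change CStarMatrix.map (algebraMap ℂ (CStarMatrix n n B) r) φ = _
    ext i j
    simp only [CStarMatrix.map_apply, CStarMatrix.algebraMap_apply]
    split_ifs
    · exact AlgHomClass.commutes φ r
    · exact map_zero φ
  map_star' X := by ext i j; simp [CStarMatrix.star_apply, map_star]

variable (A n) in
/-- The identity, from matrices with the supremum norm to matrices with the C⋆-norm. -/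
def ofPiL : (n → n → A) →L[ℂ] CStarMatrix n n A where
  toFun X := CStarMatrix.ofMatrix X
  map_add' _ _ := rfl
  map_smul' _ _ := rfl
  cont := continuous_id

/-- All conditions can be checked on the finitely many entries. The bound may grow with the matrix
size through the comparison of the supremum norm with the C⋆-norm, which is harmless since the size
stays fixed along the filter. -/
lemma AsympRetract.matrix {l : Filter ι} {φ : B →⋆ₐ[ℂ] A} {ψ : ι → A →ₗ[ℂ] B}
    (H : AsympRetract l φ ψ) :
    AsympRetract l (cmatMap n φ) (fun i => CStarMatrix.mapₗ (m := n) (n := n) (ψ i)) where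
  apply_star i X := by
    ext a b
    simp [CStarMatrix.star_apply, H.apply_star]
  bound := by
    obtain ⟨C, hC0, hC⟩ := H.bound
    refine ⟨‖ofPiL B n‖ * C, by positivity, fun i X => ?_⟩
    let Y : n → n → B := fun a b => ψ i (X a b)
    have hY : ‖Y‖ ≤ C * ‖X‖ := by
      have h0 : 0 ≤ C * ‖X‖ := by positivity
      refine (pi_norm_le_iff_of_nonneg h0).2 fun a => (pi_norm_le_iff_of_nonneg h0).2 fun b => ?_
      exact (hC i _).trans (mul_le_mul_of_nonneg_left CStarMatrix.norm_entry_le_norm hC0)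
    calc ‖CStarMatrix.mapₗ (ψ i) X‖ = ‖ofPiL B n Y‖ := rfl
      _ ≤ ‖ofPiL B n‖ * ‖Y‖ := (ofPiL B n).le_opNorm Y
      _ ≤ ‖ofPiL B n‖ * (C * ‖X‖) := by gcongr
      _ = ‖ofPiL B n‖ * C * ‖X‖ := by ring
  tendsto_mul X Y := by
    rw [tendsto_cstarMatrix]
    intro a b
    have h := tendsto_finsetSum (Finset.univ : Finset n) fun c _ => H.tendsto_mul (X a c) (Y c b)
    simpa [CStarMatrix.mul_apply, Finset.sum_sub_distrib] using h
  retract X := tendsto_cstarMatrix.2 fun a b => H.retract (X a b)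

lemma tracks_cstarMatrix {l : Filter ι} {ψ : ι → A →ₗ[ℂ] B} {X : CStarMatrix n n A}
    {F : ι → CStarMatrix n n B} :
    Tracks l (fun i => CStarMatrix.mapₗ (m := n) (n := n) (ψ i)) X F ↔
      ∀ a b, Tracks l ψ (X a b) (fun i => F i a b) :=
  tendsto_cstarMatrix

end MatrixRetract

/-! ### Divisibility in `K₀`. -/

section KZero

variable {A B ι : Type*} [CStarAlgebra A] [CStarAlgebra B] {l : Filter ι} {φ : B →⋆ₐ[ℂ] A}
  {ψ : ι → A →ₗ[ℂ] B}

lemma mvn_fromBlocks_left {m n : Type*} [Fintype m] [Fintype n] [DecidableEq m] [DecidableEq n]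
    {p : Matrix m m A} (hp : IsStarProjection p) :
    MvN p (Matrix.fromBlocks p 0 0 (0 : Matrix n n A)) := by
  have h1 : pᴴ = p := hp.isSelfAdjoint
  have h2 : p * p = p := hp.isIdempotentElem
  refine ⟨Matrix.fromCols p 0, ?_, ?_⟩
  · simp [Matrix.conjTranspose_fromCols_eq_fromRows_conjTranspose, Matrix.fromCols_mul_fromRows,
      h1, h2]
  · rw [Matrix.conjTranspose_fromCols_eq_fromRows_conjTranspose, Matrix.fromRows_mul_fromCols]
    simp [h1, h2]

lemma mvn_fromBlocks_right {m n : Type*} [Fintype m] [Fintype n] [DecidableEq m] [DecidableEq n]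
    {p : Matrix n n A} (hp : IsStarProjection p) :
    MvN p (Matrix.fromBlocks (0 : Matrix m m A) 0 0 p) := by
  have h1 : pᴴ = p := hp.isSelfAdjoint
  have h2 : p * p = p := hp.isIdempotentElem
  refine ⟨Matrix.fromCols 0 p, ?_, ?_⟩
  · simp [Matrix.conjTranspose_fromCols_eq_fromRows_conjTranspose, Matrix.fromCols_mul_fromRows,
      h1, h2]
  · rw [Matrix.conjTranspose_fromCols_eq_fromRows_conjTranspose, Matrix.fromRows_mul_fromCols]
    simp [h1, h2]

lemma AsympRetract.eventually_mvn_square (H : AsympRetract l φ ψ) {n : Type*} [Fintype n]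
    [DecidableEq n] {p q : Matrix n n A} (hp : IsStarProjection p)
    (hq : IsStarProjection q) (h : MvN p q) {p' q' : ι → Matrix n n B}
    (hp' : ∀ i, IsStarProjection (p' i)) (hq' : ∀ i, IsStarProjection (q' i))
    (htp : ∀ a b, Tracks l ψ (p a b) (fun i => p' i a b))
    (htq : ∀ a b, Tracks l ψ (q a b) (fun i => q' i a b)) : ∀ᶠ i in l, MvN (p' i) (q' i) := by
  -- The C⋆-algebra structure on matrices needs an order on the coefficients; the spectral order is
  -- chosen locally here.
  let _ := CStarAlgebra.spectralOrder A
  have _ := CStarAlgebra.spectralOrderedRing A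
  let _ := CStarAlgebra.spectralOrder B
  have _ := CStarAlgebra.spectralOrderedRing B
  obtain ⟨v, hv, hv'⟩ := h
  exact (H.matrix (n := n)).eventually_exists_partialIsometry
    (p := CStarMatrix.ofMatrix p) (q := CStarMatrix.ofMatrix q) (v := CStarMatrix.ofMatrix v)
    (p' := fun i => CStarMatrix.ofMatrix (p' i)) (q' := fun i => CStarMatrix.ofMatrix (q' i))
    ⟨hp.1, hp.2⟩ ⟨hq.1, hq.2⟩ hv hv' (fun i => ⟨(hp' i).1, (hp' i).2⟩)
    (fun i => ⟨(hq' i).1, (hq' i).2⟩) (tracks_cstarMatrix.2 htp) (tracks_cstarMatrix.2 htq)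

lemma AsympRetract.tracks_zero (H : AsympRetract l φ ψ) : Tracks l ψ 0 (fun _ => 0) := by
  simpa using H.tracks_map 0

lemma AsympRetract.tracks_fromBlocks (H : AsympRetract l φ ψ) {m n : Type*} {p : Matrix m m A}
    {q : Matrix n n A} {p' : ι → Matrix m m B} {q' : ι → Matrix n n B}
    (htp : ∀ a b, Tracks l ψ (p a b) (fun i => p' i a b))
    (htq : ∀ a b, Tracks l ψ (q a b) (fun i => q' i a b)) (a b : m ⊕ n) :
    Tracks l ψ (Matrix.fromBlocks p 0 0 q a b)
      (fun i => Matrix.fromBlocks (p' i) 0 0 (q' i) a b) := by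
  rcases a with a | a <;> rcases b with b | b
  · exact htp a b
  · exact H.tracks_zero
  · exact H.tracks_zero
  · exact htq a b

/-- Padding both projections with zero blocks to the common index type `m ⊕ n` reduces to square
matrices. -/
lemma AsympRetract.eventually_mvn (H : AsympRetract l φ ψ) {m n : Type*} [Fintype m]
    [DecidableEq m] [Fintype n] [DecidableEq n] {p : Matrix m m A} {q : Matrix n n A}
    (hp : IsStarProjection p) (hq : IsStarProjection q) (h : MvN p q)
    {p' : ι → Matrix m m B} {q' : ι → Matrix n n B}
    (hp' : ∀ i, IsStarProjection (p' i)) (hq' : ∀ i, IsStarProjection (q' i))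
    (htp : ∀ a b, Tracks l ψ (p a b) (fun i => p' i a b))
    (htq : ∀ a b, Tracks l ψ (q a b) (fun i => q' i a b)) : ∀ᶠ i in l, MvN (p' i) (q' i) := by
  have hp0 := isStarProjection_blocks hp (IsStarProjection.zero (Matrix n n A))
  have hq0 := isStarProjection_blocks (IsStarProjection.zero (Matrix m m A)) hq
  have hpq : MvN (Matrix.fromBlocks p 0 0 (0 : Matrix n n A))
      (Matrix.fromBlocks (0 : Matrix m m A) 0 0 q) :=
    (mvn_fromBlocks_left hp).symm.trans hp0 hq0 (h.trans hp hq0 (mvn_fromBlocks_right hq))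
  have ev := H.eventually_mvn_square hp0 hq0 hpq
    (p' := fun i => Matrix.fromBlocks (p' i) 0 0 (0 : Matrix n n B))
    (q' := fun i => Matrix.fromBlocks (0 : Matrix m m B) 0 0 (q' i))
    (fun i => isStarProjection_blocks (hp' i) (IsStarProjection.zero _))
    (fun i => isStarProjection_blocks (IsStarProjection.zero _) (hq' i))
    (H.tracks_fromBlocks htp fun _ _ => H.tracks_zero)
    (H.tracks_fromBlocks (fun _ _ => H.tracks_zero) htq)
  filter_upwards [ev] with i hi
  have h1 := isStarProjection_blocks (hp' i) (IsStarProjection.zero (Matrix n n B))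
  have h2 := isStarProjection_blocks (IsStarProjection.zero (Matrix m m B)) (hq' i)
  exact (mvn_fromBlocks_left (hp' i)).trans (hp' i) (hq' i)
    (hi.trans h1 (hq' i) (mvn_fromBlocks_right (hq' i)).symm)

/-- The family `x'` in `V(B)` is represented by projections asymptotic to the image under `ψ` of a
projection representing `x`. -/
def IsLift (l : Filter ι) (ψ : ι → A →ₗ[ℂ] B) (x : V A) (x' : ι → V B) : Prop :=
  ∃ (n : ℕ) (p : Matrix (Fin n) (Fin n) A) (hp : IsStarProjection p)
    (p' : ι → Matrix (Fin n) (Fin n) B) (hp' : ∀ i, IsStarProjection (p' i)),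
    x = V.mk p hp ∧ (∀ i, x' i = V.mk (p' i) (hp' i)) ∧
      ∀ a b, Tracks l ψ (p a b) (fun i => p' i a b)

namespace AsympRetract

variable (H : AsympRetract l φ ψ)
include H

lemma exists_isLift (x : V A) : ∃ x', IsLift l ψ x x' := by
  induction x using V.ind with | _ n p hp
  let _ := CStarAlgebra.spectralOrder A
  have _ := CStarAlgebra.spectralOrderedRing A
  let _ := CStarAlgebra.spectralOrder B
  have _ := CStarAlgebra.spectralOrderedRing B
  obtain ⟨p', hp', ht⟩ := (H.matrix (n := Fin n)).exists_tracks_projection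
    (p := CStarMatrix.ofMatrix p) ⟨hp.1, hp.2⟩
  have hp'' : ∀ i, IsStarProjection (CStarMatrix.ofMatrix.symm (p' i)) := fun i =>
    ⟨(hp' i).1, (hp' i).2⟩
  exact ⟨fun i => V.mk _ (hp'' i), n, p, hp, _, hp'', rfl, fun _ => rfl, tracks_cstarMatrix.1 ht⟩

lemma isLift_map (y : V B) : IsLift l ψ (V.map φ y) (fun _ => y) := by
  induction y using V.ind with | _ n p hp
  exact ⟨n, p.map φ, isStarProjection_map φ hp, fun _ => p, fun _ => hp, rfl, fun _ => rfl,
    fun a b => H.tracks_map (p a b)⟩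

lemma isLift_add {x y : V A} {x' y' : ι → V B} (hx : IsLift l ψ x x') (hy : IsLift l ψ y y') :
    IsLift l ψ (x + y) (fun i => x' i + y' i) := by
  obtain ⟨m, p, hp, p', hp', rfl, hx', htp⟩ := hx
  obtain ⟨n, q, hq, q', hq', rfl, hy', htq⟩ := hy
  refine ⟨m + n, dsum p q, isStarProjection_dsum hp hq, fun i => dsum (p' i) (q' i),
    fun i => isStarProjection_dsum (hp' i) (hq' i), rfl, fun i => ?_, fun a b => ?_⟩
  · change x' i + y' i = _
    rw [hx', hy', V.mk_add_mk]
  · exact H.tracks_fromBlocks htp htq (finSumFinEquiv.symm a) (finSumFinEquiv.symm b)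

lemma isLift_nsmul {x : V A} {x' : ι → V B} (hx : IsLift l ψ x x') (k : ℕ) :
    IsLift l ψ (k • x) (fun i => k • x' i) := by
  induction k with
  | zero => simpa using H.isLift_map 0
  | succ k ih => simpa only [succ_nsmul] using H.isLift_add ih hx

/-- Together with additivity, this makes lifting a homomorphism on `V` up to eventual equality,
independent of the representing projections and their sizes. -/
lemma isLift_unique {x : V A} {x' x'' : ι → V B} (h : IsLift l ψ x x') (h' : IsLift l ψ x x'') :
    ∀ᶠ i in l, x' i = x'' i := by
  obtain ⟨m, p, hp, p', hp', rfl, hx', htp⟩ := h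
  obtain ⟨n, q, hq, q', hq', hpq, hx'', htq⟩ := h'
  filter_upwards [H.eventually_mvn hp hq (V.mk_eq_mk.1 hpq) hp' hq' htp htq] with i hi
  rw [hx', hx'', V.mk_eq_mk]
  exact hi

end AsympRetract

open Algebra.GrothendieckAddGroup in
lemma exists_of_sub_of {M : Type*} [AddCommMonoid M] (g : Algebra.GrothendieckAddGroup M) :
    ∃ x y : M, g = of x - of y := by
  induction g using AddLocalization.induction_on with | _ z
  obtain ⟨x, y⟩ := z
  refine ⟨x, y, ?_⟩
  have h : ∀ m : M, (of m : Algebra.GrothendieckAddGroup M) = AddLocalization.mk m 0 := fun m =>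
    (AddLocalization.mk_zero_eq_addMonoidOf_mk m).symm
  rw [h, h, mk_sub_mk]
  simp only [ZeroMemClass.coe_zero, add_zero, zero_add]

open Algebra.GrothendieckAddGroup in
lemma of_eq_of_iff {M : Type*} [AddCommMonoid M] {x y : M} :
    (of x : Algebra.GrothendieckAddGroup M) = of y ↔ ∃ c, c + x = c + y := by
  have h : ∀ m : M, (of m : Algebra.GrothendieckAddGroup M) = AddLocalization.mk m 0 := fun m =>
    (AddLocalization.mk_zero_eq_addMonoidOf_mk m).symm
  rw [h, h, AddLocalization.mk_eq_mk_iff, AddLocalization.r_iff_exists]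
  simp

lemma K0.map_of (φ : B →⋆ₐ[ℂ] A) (x : V B) :
    K0.map φ (Algebra.GrothendieckAddGroup.of x) = Algebra.GrothendieckAddGroup.of (V.map φ x) :=
  congrArg (fun f => f x) (Algebra.GrothendieckAddGroup.lift.symm_apply_apply
    (Algebra.GrothendieckAddGroup.of.comp (V.map φ)))

-- With `g = x - y` and `b = r - s`, the hypothesis becomes an identity in `V(A)` after adding some
-- `t`. Lifting `x`, `y`, `t` and keeping `r`, `s` constant, the identity holds in `V(B)` at some
-- index, and `x' i - y' i` is the required class.
open Algebra.GrothendieckAddGroup in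
lemma AsympRetract.exists_nsmul_K0 [l.NeBot] (H : AsympRetract l φ ψ) (k : ℕ) (g : K0 A) (b : K0 B)
    (h : k • g = K0.map φ b) : ∃ b' : K0 B, k • b' = b := by
  obtain ⟨x, y, rfl⟩ := exists_of_sub_of g
  obtain ⟨r, s, rfl⟩ := exists_of_sub_of b
  have h1 : (of (k • x + V.map φ s) : K0 A) = of (V.map φ r + k • y) := by
    rw [map_sub, K0.map_of, K0.map_of, smul_sub, sub_eq_sub_iff_add_eq_add] at h
    simpa only [map_add, map_nsmul] using h
  obtain ⟨t, ht⟩ := of_eq_of_iff.1 h1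
  obtain ⟨x', hx'⟩ := H.exists_isLift x
  obtain ⟨y', hy'⟩ := H.exists_isLift y
  obtain ⟨t', ht'⟩ := H.exists_isLift t
  have l1 := H.isLift_add ht' (H.isLift_add (H.isLift_nsmul hx' k) (H.isLift_map s))
  have l2 := H.isLift_add ht' (H.isLift_add (H.isLift_map r) (H.isLift_nsmul hy' k))
  rw [ht] at l1
  obtain ⟨i, hi⟩ := (H.isLift_unique l1 l2).exists
  refine ⟨of (x' i) - of (y' i), ?_⟩
  have h2 : (of (k • x' i + s) : K0 B) = of (r + k • y' i) := of_eq_of_iff.2 ⟨_, hi⟩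
  rw [smul_sub, sub_eq_sub_iff_add_eq_add]
  simpa only [map_add, map_nsmul] using h2

end KZero

/-! ### Divisibility in `K₁`. -/

section KOne

variable {A B ι : Type*} [CStarAlgebra A] [CStarAlgebra B] {l : Filter ι} {φ : B →⋆ₐ[ℂ] A}
  {ψ : ι → A →ₗ[ℂ] B}

/-- Unitary matrices as unitaries of the C⋆-algebra of matrices. -/
def unitaryCStarMatrix (A : Type*) [CStarAlgebra A] (n : ℕ) :
    U A n ≃* unitary (CStarMatrix (Fin n) (Fin n) A) where
  toFun u := ⟨CStarMatrix.ofMatrix u.1, u.2⟩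
  invFun u := ⟨CStarMatrix.ofMatrix.symm u.1, u.2⟩
  left_inv _ := rfl
  right_inv _ := rfl
  map_mul' _ _ := rfl

lemma AsympRetract.exists_joined_pow_matrix [l.NeBot] (H : AsympRetract l φ ψ) {n : ℕ}
    {u : U A n} {w : U B n} {k : ℕ} (h : Joined 1 (u ^ k * (uMap φ n w)⁻¹)) :
    ∃ u' : U B n, Joined 1 (u' ^ k * w⁻¹) := by
  let _ := CStarAlgebra.spectralOrder A
  have _ := CStarAlgebra.spectralOrderedRing A
  let _ := CStarAlgebra.spectralOrder B
  have _ := CStarAlgebra.spectralOrderedRing B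
  have c1 : Continuous (unitaryCStarMatrix A n) :=
    Continuous.subtype_mk (continuous_subtype_val (p := (· ∈ unitary (Matrix (Fin n) (Fin n) A)))) _
  have c2 : Continuous (unitaryCStarMatrix B n).symm :=
    Continuous.subtype_mk
      (continuous_subtype_val (p := (· ∈ unitary (CStarMatrix (Fin n) (Fin n) B)))) _
  have h1 := h.map c1
  rw [map_one] at h1
  obtain ⟨u', hu'⟩ := (H.matrix (n := Fin n)).exists_joined_pow
    (u := unitaryCStarMatrix A n u) (w := unitaryCStarMatrix B n w) (k := k) (by
      rw [map_mul, map_pow]; rfl) h1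
  refine ⟨(unitaryCStarMatrix B n).symm u', ?_⟩
  have h2 := hu'.map c2
  rwa [map_one, map_mul, map_inv, map_pow, MulEquiv.symm_apply_apply] at h2

lemma Uinf.exists_stab_eq {m n : ℕ} {u : U A m} {v : U A n} (h : Uinf.mk u = Uinf.mk v) :
    ∃ (N : ℕ) (hm : m ≤ N) (hn : n ≤ N), stab A m N hm u = stab A n N hn v :=
  Quotient.exact h

lemma mem_Uinf0_iff {n : ℕ} {u : U A n} :
    Uinf.mk u ∈ Uinf0 A ↔ ∃ (N : ℕ) (h : n ≤ N), Joined 1 (stab A n N h u) := by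
  constructor
  · rintro ⟨m, z, hz, he⟩
    obtain ⟨N, hm, hn, e⟩ := Uinf.exists_stab_eq he
    exact ⟨N, hn, e ▸ joined_one_stab hm hz⟩
  · rintro ⟨N, h, hj⟩
    exact ⟨N, _, hj, Uinf.mk_stab h u⟩

lemma Uinf.mk_pow {n : ℕ} (u : U A n) (k : ℕ) : Uinf.mk u ^ k = Uinf.mk (u ^ k) := by
  induction k with
  | zero => exact (pow_zero _).trans (DirectLimit.one_def (f := stab A) n)
  | succ k ih => rw [pow_succ, ih, Uinf.mk_mul, pow_succ]

/-- At a large enough matrix size the hypothesis is a path from `1` to `uᵏ φ(w)⁻¹`. Lifting `u` to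
`u'` and keeping `w` gives `u'ᵏ w⁻¹` joined to `1` over `B`, so the class of `u'` works. -/
lemma AsympRetract.exists_nsmul_K1 [l.NeBot] (H : AsympRetract l φ ψ) (k : ℕ) (g : K1 A) (b : K1 B)
    (h : k • g = K1.map φ b) : ∃ b' : K1 B, k • b' = b := by
  obtain ⟨g, rfl⟩ := Additive.ofMul.surjective g
  obtain ⟨b, rfl⟩ := Additive.ofMul.surjective b
  obtain ⟨x, rfl⟩ := QuotientGroup.mk_surjective g
  obtain ⟨y, rfl⟩ := QuotientGroup.mk_surjective b
  obtain ⟨m, u, rfl⟩ := Uinf.exists_mk x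
  obtain ⟨n, w, rfl⟩ := Uinf.exists_mk y
  obtain ⟨N, u, w, hu, hw⟩ : ∃ (N : ℕ) (u' : U A N) (w' : U B N),
      Uinf.mk u = Uinf.mk u' ∧ Uinf.mk w = Uinf.mk w' :=
    ⟨max m n, _, _, (Uinf.mk_stab (le_max_left m n) u).symm,
      (Uinf.mk_stab (le_max_right m n) w).symm⟩
  rw [hu, hw] at h
  rw [hw]
  have h1 : ((Uinf.mk u ^ k : Uinf A) : Uinf A ⧸ Uinf0 A) = (Uinf.map φ (Uinf.mk w) : Uinf A) := h
  rw [eq_comm, QuotientGroup.eq, Uinf.map_mk, Uinf.mk_pow, Uinf.mk_inv] at h1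
  have h2 : Uinf.mk (u ^ k * (uMap φ N w)⁻¹) ∈ Uinf0 A := by
    have := (inferInstance : (Uinf0 A).Normal).mem_comm h1
    rwa [Uinf.mk_mul] at this
  obtain ⟨M, hM, hj⟩ := mem_Uinf0_iff.1 h2
  rw [map_mul, map_pow, map_inv, ← uMap_stab] at hj
  obtain ⟨u', hu'⟩ := H.exists_joined_pow_matrix hj
  refine ⟨Additive.ofMul (QuotientGroup.mk (Uinf.mk u')), ?_⟩
  change Additive.ofMul (QuotientGroup.mk (Uinf.mk u' ^ k)) = _
  congr 1
  rw [eq_comm, QuotientGroup.eq, ← Uinf.mk_stab hM w, Uinf.mk_pow, Uinf.mk_inv]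
  refine (inferInstance : (Uinf0 B).Normal).mem_comm ?_
  rw [Uinf.mk_mul]
  exact ⟨M, _, hu', rfl⟩

end KOne

end CStarK

/-! ### Abelian groups: consequences of the divisibility property. -/

section PureSubgroup

variable {G H : Type*} [AddCommGroup G] [AddCommGroup H]

/-- For any representative `g`, the element `k • g` is `f b`, hence `k • f b'`; subtracting `f b'`
kills the multiple without changing the class. -/
lemma exists_lift_nsmul_eq_zero {f : H →+ G}
    (hf : ∀ (k : ℕ) (g : G) (b : H), k • g = f b → ∃ b', k • b' = b) (x : G ⧸ f.range) {k : ℕ}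
    (hx : k • x = 0) : ∃ g : G, (QuotientAddGroup.mk g : G ⧸ f.range) = x ∧ k • g = 0 := by
  obtain ⟨g, rfl⟩ := QuotientAddGroup.mk_surjective x
  obtain ⟨b, hb⟩ : k • g ∈ f.range := (QuotientAddGroup.eq_zero_iff _).1 hx
  obtain ⟨b', rfl⟩ := hf k g b hb.symm
  refine ⟨g - f b', ?_, ?_⟩
  · rw [QuotientAddGroup.eq]
    exact ⟨b', by abel⟩
  · rw [smul_sub, ← map_nsmul, hb, sub_self]

lemma injective_of_nsmul_lift {f : H →+ G}
    (hf : ∀ (k : ℕ) (g : G) (b : H), k • g = f b → ∃ b', k • b' = b) : Function.Injective f := by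
  refine (injective_iff_map_eq_zero f).2 fun b hb => ?_
  obtain ⟨b', hb'⟩ := hf 0 0 b (by rw [hb, smul_zero])
  rw [← hb', zero_smul]

/-- A lift annihilated by the order of `x` has order dividing it, and the order can only drop under
the quotient map, so the two agree. -/
lemma isPure_range_of_nsmul_lift {f : H →+ G}
    (hf : ∀ (k : ℕ) (g : G) (b : H), k • g = f b → ∃ b', k • b' = b) : f.range.IsPure := by
  intro x hx
  obtain ⟨g, hg, hg0⟩ := exists_lift_nsmul_eq_zero hf x (addOrderOf_nsmul_eq_zero x)
  refine ⟨g, hg, isOfFinAddOrder_iff_nsmul_eq_zero.2 ⟨_, hx.addOrderOf_pos, hg0⟩,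
    Nat.dvd_antisymm (addOrderOf_dvd_of_nsmul_eq_zero hg0) ?_⟩
  rw [← hg]
  exact addOrderOf_map_dvd (QuotientAddGroup.mk' f.range) g

-- The quotient is a sum of copies of `ℤ` and of cyclic groups of prime power order. Free generators
-- lift arbitrarily, and each finite cyclic generator lifts to an element killed by its order, so
-- the assignment extends to a homomorphism.
open DirectSum in
lemma exists_section_of_nsmul_lift [AddGroup.FG G] {f : H →+ G}
    (hf : ∀ (k : ℕ) (g : G) (b : H), k • g = f b → ∃ b', k • b' = b) :
    ∃ s : G ⧸ f.range →+ G, ∀ x, (QuotientAddGroup.mk (s x) : G ⧸ f.range) = x := by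
  classical
  obtain ⟨n, ι, _, p, _, e, ⟨E⟩⟩ := AddCommGroup.equiv_free_prod_directSum_zmod (G ⧸ f.range)
  let q := QuotientAddGroup.mk' f.range
  have hq : Function.Surjective q := QuotientAddGroup.mk'_surjective _
  choose a ha using fun i : Fin n => hq (E.symm (Finsupp.single i 1, 0))
  have hc : ∀ i : ι, ∃ g : G, q g = E.symm (0, of (fun i => ZMod (p i ^ e i)) i 1) ∧
      (p i ^ e i) • g = 0 := fun i => by
    refine exists_lift_nsmul_eq_zero hf _ ?_
    rw [← map_nsmul, Prod.smul_mk, smul_zero, ← map_nsmul]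
    simp
  choose c hc hc0 using hc
  have hz : ∀ i, zmultiplesHom G (c i) ((p i ^ e i : ℕ) : ℤ) = 0 := fun i => by
    rw [zmultiplesHom_apply, natCast_zsmul, hc0]
  let t₁ : (Fin n →₀ ℤ) →+ G := Finsupp.liftAddHom fun i => zmultiplesHom G (a i)
  let t₂ : (⨁ i : ι, ZMod (p i ^ e i)) →+ G := toAddMonoid fun i =>
    ZMod.lift (p i ^ e i) ⟨zmultiplesHom G (c i), hz i⟩
  have h₁ : q.comp t₁ = E.symm.toAddMonoidHom.comp (AddMonoidHom.inl _ _) := by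
    ext i
    simpa [t₁] using ha i
  have h₂ : q.comp t₂ = E.symm.toAddMonoidHom.comp (AddMonoidHom.inr _ _) := by
    refine DirectSum.addHom_ext fun i y => ?_
    obtain ⟨z, rfl⟩ := ZMod.intCast_surjective y
    have e1 : of (fun i => ZMod (p i ^ e i)) i (z : ZMod (p i ^ e i)) =
        z • of (fun i => ZMod (p i ^ e i)) i 1 := by
      rw [← map_zsmul]; simp
    rw [e1, map_zsmul, map_zsmul]
    congr 1
    have e2 : t₂ (of (fun i => ZMod (p i ^ e i)) i 1) = c i := by
      have := ZMod.lift_coe (p i ^ e i) ⟨zmultiplesHom G (c i), hz i⟩ 1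
      simpa [t₂] using this
    simpa [e2] using hc i
  refine ⟨(t₁.coprod t₂).comp E.toAddMonoidHom, fun x => ?_⟩
  have h3 : ∀ y, q (t₁.coprod t₂ y) = E.symm y := fun y => by
    have e1 := DFunLike.congr_fun h₁ y.1
    have e2 := DFunLike.congr_fun h₂ y.2
    simp only [AddMonoidHom.comp_apply] at e1 e2
    rw [AddMonoidHom.coprod_apply, map_add, e1, e2]
    simp [← map_add]
  exact (h3 (E x)).trans (E.symm_apply_apply x)

lemma exists_retraction_of_nsmul_lift [AddGroup.FG G] {f : H →+ G}
    (hf : ∀ (k : ℕ) (g : G) (b : H), k • g = f b → ∃ b', k • b' = b) :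
    ∃ π : G →+ H, π.comp f = AddMonoidHom.id H := by
  obtain ⟨s, hs⟩ := exists_section_of_nsmul_lift hf
  have hi := injective_of_nsmul_lift hf
  let q := QuotientAddGroup.mk' f.range
  -- A section `s` of the quotient map makes `g ↦ g - s(q g)` a projection onto the range; composing
  -- with the inverse of `f` on its range gives `π`.
  let r : G →+ f.range := (AddMonoidHom.id G - s.comp q).codRestrict f.range fun g => by
    refine (QuotientAddGroup.eq_zero_iff _).1 ?_
    change q (g - s (q g)) = 0
    rw [map_sub, sub_eq_zero]
    exact (hs (q g)).symm
  refine ⟨(AddMonoidHom.ofInjective hi).symm.toAddMonoidHom.comp r, ?_⟩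
  ext b
  have hb : q (f b) = 0 := (QuotientAddGroup.eq_zero_iff _).2 ⟨b, rfl⟩
  change (AddMonoidHom.ofInjective hi).symm (r (f b)) = b
  rw [AddEquiv.symm_apply_eq]
  apply Subtype.ext
  change f b - s (q (f b)) = f b
  rw [hb, map_zero, sub_zero]

end PureSubgroup

open Filter Topology MeasureTheory AddCircle

/-! ### Spectral subspaces and Fourier coefficients of a circle action. -/

section CircleAction

variable {A : Type*} [CStarAlgebra A] (α : Circle →* (A ≃⋆ₐ[ℂ] A))

lemma norm_action_apply (ζ : Circle) (a : A) : ‖α ζ a‖ = ‖a‖ :=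
  NonUnitalStarAlgHom.norm_map (α ζ) (α ζ).injective a

/-- The automorphism `α ζ` as a continuous linear map. -/
def actionCLM (ζ : Circle) : A →L[ℂ] A :=
  LinearMap.mkContinuous { toFun := α ζ, map_add' := map_add _, map_smul' := map_smul _ } 1
    fun a => by simp [norm_action_apply]

lemma actionCLM_apply (ζ : Circle) (a : A) : actionCLM α ζ a = α ζ a := rfl

/-- The spectral subspace of degree `n` of a circle action. -/
def spectralSubspace (n : ℤ) : Submodule ℂ A where
  carrier := {a | ∀ ζ : Circle, α ζ a = ((ζ ^ n : Circle) : ℂ) • a}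
  add_mem' ha hb ζ := by rw [map_add, ha ζ, hb ζ, smul_add]
  zero_mem' ζ := by simp
  smul_mem' c a ha ζ := by rw [map_smul, ha ζ, smul_comm]

variable {α}

lemma mem_spectralSubspace {n : ℤ} {a : A} :
    a ∈ spectralSubspace α n ↔ ∀ ζ : Circle, α ζ a = ((ζ ^ n : Circle) : ℂ) • a := Iff.rfl

lemma mul_mem_spectralSubspace {m n : ℤ} {a b : A} (ha : a ∈ spectralSubspace α m)
    (hb : b ∈ spectralSubspace α n) : a * b ∈ spectralSubspace α (m + n) := fun ζ => by
  rw [map_mul, ha ζ, hb ζ, smul_mul_smul_comm, zpow_add, Circle.coe_mul]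

lemma star_mem_spectralSubspace {n : ℤ} {a : A} (ha : a ∈ spectralSubspace α n) :
    star a ∈ spectralSubspace α (-n) := fun ζ => by
  rw [map_star, ha ζ, star_smul, zpow_neg, Circle.coe_inv_eq_conj]
  rfl

lemma one_mem_spectralSubspace : (1 : A) ∈ spectralSubspace α 0 := fun ζ => by simp

lemma pow_mem_spectralSubspace {n : ℤ} {a : A} (ha : a ∈ spectralSubspace α n) (k : ℕ) :
    a ^ k ∈ spectralSubspace α (k * n) := by
  induction k with
  | zero => simpa using one_mem_spectralSubspace
  | succ k ih =>
    have := mul_mem_spectralSubspace ih ha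
    rw [pow_succ]
    convert this using 2
    push_cast
    ring

lemma mem_fixedPointAlgebra_iff {a : A} :
    a ∈ fixedPointAlgebra α ↔ a ∈ spectralSubspace α 0 := by
  have h : ∀ ζ : Circle, ((ζ ^ (0 : ℤ) : Circle) : ℂ) • a = a := fun ζ => by simp
  rw [mem_spectralSubspace]
  simp only [h]
  rfl

variable (hα : ∀ a : A, Continuous fun ζ : Circle => α ζ a)
include hα

lemma continuous_action_toCircle (a : A) :
    Continuous fun t : UnitAddCircle => α (toCircle t) a :=
  (hα a).comp continuous_toCircle

lemma integrable_fourier_action (n : ℤ) (a : A) :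
    Integrable (fun t : UnitAddCircle => fourier n t • α (toCircle t) a) haarAddCircle :=
  (by
    have := continuous_action_toCircle hα a
    fun_prop : Continuous fun t : UnitAddCircle => fourier n t • α (toCircle t) a)
    |>.integrable_of_hasCompactSupport (HasCompactSupport.of_compactSpace _)

omit hα in
lemma toCircle_surjective_unit : Function.Surjective (toCircle : UnitAddCircle → Circle) := by
  intro ζ
  obtain ⟨t, ht⟩ := (homeomorphCircle (T := (1 : ℝ)) one_ne_zero).surjective ζ
  exact ⟨t, by rw [← ht, homeomorphCircle_apply]⟩

/-- Applying `α_s` under the integral translates the variable by `s` and produces the factor `sⁿ`;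
translation invariance of Haar measure does the rest. -/
lemma fourierCoeff_mem_spectralSubspace (n : ℤ) (a : A) :
    fourierCoeff (fun t : UnitAddCircle => α (toCircle t) a) n ∈ spectralSubspace α n := by
  intro ζ
  obtain ⟨s, rfl⟩ := toCircle_surjective_unit ζ
  have h1 := (actionCLM α (toCircle s)).integral_comp_comm (integrable_fourier_action hα (-n) a)
  rw [fourierCoeff, ← actionCLM_apply, ← h1]
  have h2 : ∀ t : UnitAddCircle, actionCLM α (toCircle s) (fourier (-n) t • α (toCircle t) a) =
      ((toCircle s ^ n : Circle) : ℂ) • (fourier (-n) (s + t) • α (toCircle (s + t)) a) := fun t => by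
    rw [map_smul, actionCLM_apply, toCircle_add, map_mul, smul_smul]
    congr 1
    rw [fourier_apply, fourier_apply, ← Circle.coe_mul, toCircle_zsmul, toCircle_zsmul,
      toCircle_add, mul_zpow, ← mul_assoc, ← zpow_add, add_neg_cancel, zpow_zero, one_mul]
  simp_rw [h2]
  rw [integral_smul, integral_add_left_eq_self
    (fun t : UnitAddCircle => fourier (-n) t • α (toCircle t) a) s]

omit hα in
lemma fourierCoeff_of_mem_spectralSubspace {n : ℤ} {a : A} (ha : a ∈ spectralSubspace α n)
    (m : ℤ) : fourierCoeff (fun t : UnitAddCircle => α (toCircle t) a) m = if m = n then a else 0 := by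
  have h : (fun t : UnitAddCircle => fourier (-m) t • α (toCircle t) a) =
      fun t : UnitAddCircle => (fourier (-m) t • fourier n t) • a := by
    funext t
    rw [ha, smul_assoc, fourier_apply (n := n), toCircle_zsmul]
  rw [fourierCoeff, h, integral_smul_const]
  have := congrFun (fourierCoeff_fourier (T := (1 : ℝ)) n) m
  rw [fourierCoeff] at this
  rw [this, Pi.single_apply]
  split_ifs <;> simp

/-- The spectral subspaces of a continuous circle action span a dense subspace. -/
lemma topologicalClosure_iSup_spectralSubspace :
    (⨆ n, spectralSubspace α n).topologicalClosure = ⊤ := by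
  rw [eq_top_iff]
  rintro a -
  set S := (⨆ n, spectralSubspace α n).topologicalClosure with hS
  have hle : ∀ n, spectralSubspace α n ≤ S := fun n =>
    (le_iSup _ n).trans (Submodule.le_topologicalClosure _)
  have : IsClosed (S : Set A) := Submodule.isClosed_topologicalClosure _
  have hQ : (S.mkQL a : A ⧸ S) = 0 := by
    -- By Hahn–Banach it suffices to test functionals vanishing on the closed span. For such a
    -- functional the orbit function of `a` is continuous with all Fourier coefficients zero, so its
    -- Fourier series converges to it and it vanishes at `0`.
    refine SeparatingDual.eq_zero_of_forall_dual_eq_zero (R := ℂ) fun g => ?_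
    let f : C(UnitAddCircle, ℂ) :=
      ⟨fun t => g (S.mkQL (α (toCircle t) a)), by
        have := continuous_action_toCircle hα a
        fun_prop⟩
    have hf : fourierCoeff f = 0 := by
      funext n
      have h1 := (g.comp S.mkQL).integral_comp_comm (integrable_fourier_action hα (-n) a)
      have h2 : (S.mkQL (fourierCoeff (fun t : UnitAddCircle => α (toCircle t) a) n) : A ⧸ S) = 0 :=
        (Submodule.Quotient.mk_eq_zero S).2 (hle n (fourierCoeff_mem_spectralSubspace hα n a))
      calc fourierCoeff f n = ∫ t : UnitAddCircle,
            (g.comp S.mkQL) (fourier (-n) t • α (toCircle t) a) ∂haarAddCircle := by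
            simp only [fourierCoeff, map_smul]; rfl
        _ = g (S.mkQL (fourierCoeff (fun t : UnitAddCircle => α (toCircle t) a) n)) := h1
        _ = 0 := by rw [h2, map_zero]
    have h3 := has_pointwise_sum_fourier_series_of_summable (f := f)
      (by rw [hf]; exact summable_zero) 0
    rw [hf] at h3
    simp only [Pi.zero_apply, zero_smul] at h3
    have h4 := h3.unique hasSum_zero
    simpa [f] using h4
  exact (Submodule.Quotient.mk_eq_zero S).1 hQ

end CircleAction

/-! ### Rokhlin unitaries that are exact eigenvectors. -/

section ExactUnitary

variable {A : Type*} [CStarAlgebra A] {α : Circle →* (A ≃⋆ₐ[ℂ] A)}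

-- The element `x*x` is fixed by the action, and automorphisms commute with functional calculus, so
-- its inverse square root is fixed too and does not change the degree of `x`.
open CStarK in
lemma polar_mem_spectralSubspace {n : ℤ} {x : A} (hx : x ∈ spectralSubspace α n)
    (h : ‖star x * x - 1‖ ≤ 1 / 2) : polar x ∈ spectralSubspace α n := by
  have hb : star x * x ∈ spectralSubspace α 0 := by
    simpa using mul_mem_spectralSubspace (star_mem_spectralSubspace hx) hx
  have hi : invSqrt (star x * x) ∈ spectralSubspace α 0 := by
    rw [← mem_fixedPointAlgebra_iff] at hb ⊢
    intro ζ
    have hc : Continuous (α ζ) := (actionCLM α ζ).continuous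
    have hs : IsSelfAdjoint (star x * x) := .star_mul_self x
    have h1 := StarAlgHomClass.map_cfc (S := ℂ) (α ζ) (fun t : ℝ => (√t)⁻¹) (star x * x)
      (continuousOn_inv_sqrt_spectrum h) hc hs (by rw [hb ζ]; exact hs)
    rw [hb ζ] at h1
    exact h1
  have := mul_mem_spectralSubspace hx hi
  rwa [add_zero] at this

lemma norm_fourierCoeff_sub_le (hα : ∀ a : A, Continuous fun ζ : Circle => α ζ a) {u : A} {ε : ℝ}
    (hu : ∀ ζ : Circle, ‖α ζ u - (ζ : ℂ) • u‖ ≤ ε) :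
    ‖fourierCoeff (fun t : UnitAddCircle => α (toCircle t) u) 1 - u‖ ≤ ε := by
  have h1 : fourierCoeff (fun t : UnitAddCircle => α (toCircle t) u) 1 - u =
      ∫ t : UnitAddCircle, (fourier (-1) t • α (toCircle t) u - u) ∂haarAddCircle := by
    rw [integral_sub (integrable_fourier_action hα (-1) u) (integrable_const u)]
    simp [fourierCoeff]
  rw [h1]
  refine (norm_integral_le_of_norm_le_const (C := ε) (ae_of_all _ fun t => ?_)).trans (by simp)
  have h2 : fourier (-1) t • α (toCircle t) u - u =
      (fourier (-1) t : ℂ) • (α (toCircle t) u - ((toCircle t : Circle) : ℂ) • u) := by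
    rw [smul_sub, smul_smul, fourier_apply, ← Circle.coe_mul, toCircle_zsmul]
    simp
  rw [h2, norm_smul, fourier_apply, Circle.norm_coe, one_mul]
  exact hu (toCircle t)

/-- The Rokhlin unitaries can be chosen in the spectral subspace of degree one. -/
lemma HasRokhlinProperty.exists_unitary_mem_spectralSubspace (hR : HasRokhlinProperty α)
    (hα : ∀ a : A, Continuous fun ζ : Circle => α ζ a) {ε : ℝ} (hε : 0 < ε) (F : Finset A) :
    ∃ u ∈ unitary A, u ∈ spectralSubspace α 1 ∧ ∀ a ∈ F, ‖u * a - a * u‖ < ε := by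
  set K : ℝ := ∑ a ∈ F, ‖a‖ with hK
  have hK0 : 0 ≤ K := Finset.sum_nonneg fun a _ => norm_nonneg a
  -- The first Fourier coefficient `x` satisfies `‖x*x - 1‖ ≤ 3δ`, so `1/6` meets the threshold
  -- `1/2` for the polar part `w`. Then `‖w - u‖ ≤ 7δ`, and the commutator with `a` grows from `δ`
  -- to at most `δ + 14δK`.
  set δ : ℝ := min (1 / 6) (ε / (1 + 14 * K)) with hδ
  have hδ0 : 0 < δ := by positivity
  have hδ1 : δ ≤ 1 / 6 := min_le_left _ _
  have hδ2 : δ * (1 + 14 * K) ≤ ε := (le_div_iff₀ (by positivity)).1 (min_le_right _ _)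
  obtain ⟨u, hu, h1, h2⟩ := hR δ hδ0 F
  rcases subsingleton_or_nontrivial A with hA | hA
  · refine ⟨1, one_mem _, ?_, fun a _ => ?_⟩
    · rw [Subsingleton.elim (1 : A) 0]; exact zero_mem _
    · rw [Subsingleton.elim (1 * a - a * 1) 0, norm_zero]; exact hε
  set x := fourierCoeff (fun t : UnitAddCircle => α (toCircle t) u) 1 with hx
  have hxm : x ∈ spectralSubspace α 1 := fourierCoeff_mem_spectralSubspace hα 1 u
  have hxu : ‖x - u‖ ≤ δ := norm_fourierCoeff_sub_le hα fun ζ => (h1 ζ).le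
  have hun : ‖u‖ = 1 := CStarRing.norm_of_mem_unitary hu
  have hxn : ‖x‖ ≤ 2 := by
    calc ‖x‖ = ‖(x - u) + u‖ := by simp
      _ ≤ ‖x - u‖ + ‖u‖ := norm_add_le _ _
      _ ≤ 2 := by rw [hun]; linarith
  have hus : ‖star (x - u)‖ ≤ δ := by rwa [norm_star]
  have e1 : star x * x - 1 = star (x - u) * x + star u * (x - u) := by
    rw [star_sub, sub_mul, mul_sub, Unitary.star_mul_self_of_mem hu]; abel
  have e2 : x * star x - 1 = (x - u) * star x + u * star (x - u) := by
    rw [star_sub, sub_mul, mul_sub, Unitary.mul_star_self_of_mem hu]; abel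
  have n1 : ‖star x * x - 1‖ ≤ 3 * δ := by
    rw [e1]
    calc _ ≤ ‖star (x - u)‖ * ‖x‖ + ‖star u‖ * ‖x - u‖ :=
          (norm_add_le _ _).trans (add_le_add (norm_mul_le _ _) (norm_mul_le _ _))
      _ ≤ δ * 2 + 1 * δ := by rw [norm_star u, hun]; gcongr
      _ = 3 * δ := by ring
  have n2 : ‖x * star x - 1‖ ≤ 3 * δ := by
    rw [e2]
    calc _ ≤ ‖x - u‖ * ‖star x‖ + ‖u‖ * ‖star (x - u)‖ :=
          (norm_add_le _ _).trans (add_le_add (norm_mul_le _ _) (norm_mul_le _ _))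
      _ ≤ δ * 2 + 1 * δ := by rw [norm_star x, hun]; gcongr
      _ = 3 * δ := by ring
  have n1' : ‖star x * x - 1‖ ≤ 1 / 2 := n1.trans (by linarith)
  have hw := CStarK.polar_mem_unitary n1' (n2.trans_lt (by linarith))
  set w := CStarK.polar x with hwdef
  have hwu : ‖w - u‖ ≤ 7 * δ := by
    calc ‖w - u‖ = ‖(w - x) + (x - u)‖ := by simp
      _ ≤ ‖w - x‖ + ‖x - u‖ := norm_add_le _ _
      _ ≤ 2 * (3 * δ) + δ :=
        add_le_add ((CStarK.norm_polar_sub_le n1').trans (by gcongr)) hxu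
      _ = 7 * δ := by ring
  refine ⟨w, hw, polar_mem_spectralSubspace hxm n1', fun a ha => ?_⟩
  have haK : ‖a‖ ≤ K := Finset.single_le_sum (fun b _ => norm_nonneg b) ha
  have e3 : w * a - a * w = (u * a - a * u) + ((w - u) * a - a * (w - u)) := by noncomm_ring
  calc ‖w * a - a * w‖ ≤ ‖u * a - a * u‖ + (‖w - u‖ * ‖a‖ + ‖a‖ * ‖w - u‖) := by
        rw [e3]
        exact (norm_add_le _ _).trans (add_le_add le_rfl ((norm_sub_le _ _).trans
          (add_le_add (norm_mul_le _ _) (norm_mul_le _ _))))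
    _ < δ + (7 * δ * K + K * (7 * δ)) := by
        refine add_lt_add_of_lt_of_le (h2 a ha) ?_
        gcongr
    _ = δ * (1 + 14 * K) := by ring
    _ ≤ ε := hδ2

/-- An asymptotically central net of unitaries in the spectral subspace of degree one. -/
lemma HasRokhlinProperty.exists_net (hR : HasRokhlinProperty α)
    (hα : ∀ a : A, Continuous fun ζ : Circle => α ζ a) :
    ∃ u : Finset A × ℕ → unitary A, (∀ j, (u j : A) ∈ spectralSubspace α 1) ∧
      ∀ a : A, Tendsto (fun j => (u j : A) * a - a * u j) atTop (𝓝 0) := by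
  choose u hu h1 h2 using fun j : Finset A × ℕ =>
    hR.exists_unitary_mem_spectralSubspace hα (Nat.one_div_pos_of_nat (α := ℝ) (n := j.2)) j.1
  refine ⟨fun j => ⟨u j, hu j⟩, h1, fun a => ?_⟩
  have ht : Tendsto (fun j : Finset A × ℕ => 1 / ((j.2 : ℝ) + 1)) atTop (𝓝 0) := by
    have hs : Tendsto (Prod.snd : Finset A × ℕ → ℕ) atTop atTop := by
      rw [← prod_atTop_atTop_eq]; exact tendsto_snd
    exact tendsto_one_div_add_atTop_nhds_zero_nat.comp hs
  refine squeeze_zero_norm' ?_ ht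
  filter_upwards [eventually_ge_atTop (({a} : Finset A), 0)] with j hj
  exact (h2 j a (hj.1 (Finset.mem_singleton_self a))).le

end ExactUnitary

/-! ### The average over the circle and the compressed averages. -/

section ConditionalExpectation

variable {A : Type*} [CStarAlgebra A] {α : Circle →* (A ≃⋆ₐ[ℂ] A)}
  (hα : ∀ a : A, Continuous fun ζ : Circle => α ζ a)

/-- Averaging over a continuous circle action. -/
def circleAverage : A →ₗ[ℂ] A where
  toFun a := fourierCoeff (fun t : UnitAddCircle => α (toCircle t) a) 0
  map_add' a b := by
    have h : ∀ a : A, Integrable (fun t : UnitAddCircle => α (toCircle t) a) haarAddCircle :=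
      fun a => by simpa using integrable_fourier_action hα 0 a
    simp only [map_add]
    exact fourierCoeff.add (h a) (h b) ▸ rfl
  map_smul' c a := by
    simp only [map_smul]
    exact fourierCoeff.const_smul _ c 0

lemma circleAverage_eq (a : A) :
    circleAverage hα a = ∫ t : UnitAddCircle, α (toCircle t) a ∂haarAddCircle := by
  simp [circleAverage, fourierCoeff]

lemma circleAverage_of_mem {n : ℤ} {a : A} (ha : a ∈ spectralSubspace α n) :
    circleAverage hα a = if n = 0 then a else 0 := by
  have := fourierCoeff_of_mem_spectralSubspace ha 0
  simp only [eq_comm (a := (0 : ℤ))] at this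
  exact this

lemma circleAverage_mem (a : A) : circleAverage hα a ∈ fixedPointAlgebra α :=
  mem_fixedPointAlgebra_iff.2 (fourierCoeff_mem_spectralSubspace hα 0 a)

lemma circleAverage_star (a : A) : circleAverage hα (star a) = star (circleAverage hα a) := by
  rw [circleAverage_eq, circleAverage_eq]
  have h : Integrable (fun t : UnitAddCircle => α (toCircle t) a) haarAddCircle := by
    simpa using integrable_fourier_action hα 0 a
  have := (starL' ℝ : A ≃L[ℝ] A).toContinuousLinearMap.integral_comp_comm h
  simp only [map_star]
  exact this

lemma circleAverage_nonneg [PartialOrder A] [StarOrderedRing A] {a : A} (ha : 0 ≤ a) :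
    0 ≤ circleAverage hα a := by
  rw [circleAverage_eq]
  exact integral_nonneg fun t => map_nonneg (α (toCircle t)) ha

/-- Compression of an element by a partial geometric sum of powers of `star u`, averaged over the
circle action and normalized. -/
def rokhlinMap (u : A) (N : ℕ) : A →ₗ[ℂ] fixedPointAlgebra α where
  toFun a := ⟨(N : ℂ)⁻¹ • circleAverage hα
      ((∑ k ∈ Finset.range N, star u ^ k) * a * star (∑ k ∈ Finset.range N, star u ^ k)),
    (fixedPointAlgebra α).smul_mem (circleAverage_mem hα _) _⟩
  map_add' a b := Subtype.ext (by
    change (N : ℂ)⁻¹ • circleAverage hα (_ * (a + b) * _) = _ • _ + _ • _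
    rw [mul_add, add_mul, map_add, smul_add])
  map_smul' c a := Subtype.ext (by
    change (N : ℂ)⁻¹ • circleAverage hα (_ * (c • a) * _) = c • _ • _
    rw [mul_smul_comm, smul_mul_assoc, map_smul, smul_comm])

lemma coe_rokhlinMap (u : A) (N : ℕ) (a : A) : (rokhlinMap hα u N a : A) =
    (N : ℂ)⁻¹ • circleAverage hα
      ((∑ k ∈ Finset.range N, star u ^ k) * a * star (∑ k ∈ Finset.range N, star u ^ k)) := rfl

lemma rokhlinMap_star (u : A) (N : ℕ) (a : A) :
    rokhlinMap hα u N (star a) = star (rokhlinMap hα u N a) := by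
  apply Subtype.ext
  rw [StarMemClass.coe_star, coe_rokhlinMap, coe_rokhlinMap, star_smul, ← circleAverage_star]
  simp [mul_assoc]

/-- The product `u*ᵏ a uˡ` has degree `n + l - k`, and the average keeps exactly the terms of degree
zero. -/
lemma circleAverage_compression {u : A} (hu : u ∈ spectralSubspace α 1) {n : ℤ} {a : A}
    (ha : a ∈ spectralSubspace α n) (N : ℕ) :
    circleAverage hα
      ((∑ k ∈ Finset.range N, star u ^ k) * a * star (∑ k ∈ Finset.range N, star u ^ k)) =
      ∑ k ∈ Finset.range N, ∑ l ∈ Finset.range N,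
        if (k : ℤ) = n + l then star u ^ k * a * u ^ l else 0 := by
  rw [star_sum, Finset.sum_mul, Finset.sum_mul, map_sum]
  refine Finset.sum_congr rfl fun k _ => ?_
  rw [Finset.mul_sum, map_sum]
  refine Finset.sum_congr rfl fun l _ => ?_
  rw [star_pow, star_star]
  have h := mul_mem_spectralSubspace (mul_mem_spectralSubspace
    (pow_mem_spectralSubspace (star_mem_spectralSubspace hu) k) ha) (pow_mem_spectralSubspace hu l)
  rw [circleAverage_of_mem hα h]
  refine if_congr ?_ rfl rfl
  omega

/-- Only the `N` diagonal terms survive, each equal to `1`. The scalar is left as `N⁻¹ * N` to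
include `N = 0`, where it is zero. -/
lemma rokhlinMap_one {u : A} (hu : u ∈ spectralSubspace α 1) (hu' : u ∈ unitary A) (N : ℕ) :
    (rokhlinMap hα u N 1 : A) = ((N : ℂ)⁻¹ * N) • 1 := by
  rw [coe_rokhlinMap, circleAverage_compression hα hu one_mem_spectralSubspace, mul_smul]
  congr 1
  have h : ∀ k ∈ Finset.range N, (∑ l ∈ Finset.range N,
      if (k : ℤ) = 0 + l then star u ^ k * 1 * u ^ l else 0) = 1 := fun k hk => by
    simp only [zero_add, Nat.cast_inj]
    rw [Finset.sum_ite_eq, if_pos hk, mul_one, ← star_pow,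
      Unitary.star_mul_self_of_mem (pow_mem hu' k)]
  rw [Finset.sum_congr rfl h]
  simp [Nat.cast_smul_eq_nsmul]

lemma norm_le_of_positive [PartialOrder A] [StarOrderedRing A] (f : A →ₚ[ℂ] A) (a : A) :
    ‖f a‖ ≤ 4 * ‖f 1‖ * ‖a‖ := by
  obtain ⟨y, hy, hyn, h⟩ := CStarAlgebra.exists_sum_four_nonneg a
  conv_lhs => rw [h]
  simp only [map_sum, map_smul]
  refine (norm_sum_le _ _).trans ?_
  simp only [norm_smul, norm_pow, Complex.norm_I, one_pow, one_mul]
  calc ∑ i, ‖f (y i)‖ ≤ ∑ _i : Fin 4, ‖f 1‖ * ‖a‖ := Finset.sum_le_sum fun i _ =>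
        (f.norm_apply_le_of_nonneg _ (hy i)).trans (by gcongr; exact hyn i)
    _ = 4 * ‖f 1‖ * ‖a‖ := by simp [mul_assoc]

/-- Compression and averaging preserve positivity, and a positive map is controlled by its value at
`1`. The constant `4` comes from splitting an element into four positive parts; what matters is that
it does not depend on `u` or `N`. -/
lemma norm_rokhlinMap_le {u : A} (hu : u ∈ spectralSubspace α 1) (hu' : u ∈ unitary A) (N : ℕ)
    (a : A) : ‖rokhlinMap hα u N a‖ ≤ 4 * ‖a‖ := by
  let _ := CStarAlgebra.spectralOrder A
  have _ := CStarAlgebra.spectralOrderedRing A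
  let f : A →ₚ[ℂ] A := PositiveLinearMap.mk₀
    ((fixedPointAlgebra α).subtype.toAlgHom.toLinearMap.comp (rokhlinMap hα u N)) fun x hx => by
      change 0 ≤ (rokhlinMap hα u N x : A)
      rw [coe_rokhlinMap]
      have h := smul_nonneg (inv_nonneg.2 (Nat.cast_nonneg (α := ℝ) N))
        (circleAverage_nonneg hα (star_right_conjugate_nonneg hx
          (∑ k ∈ Finset.range N, star u ^ k)))
      rw [← Complex.coe_smul] at h
      simpa using h
  have h1 : ‖f 1‖ ≤ 1 := by
    change ‖(rokhlinMap hα u N 1 : A)‖ ≤ 1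
    rw [rokhlinMap_one hα hu hu', norm_smul]
    rcases subsingleton_or_nontrivial A with hA | hA
    · rw [Subsingleton.elim (1 : A) 0, norm_zero, mul_zero]; exact zero_le_one
    · rw [CStarRing.norm_one, mul_one]
      rcases eq_or_ne N 0 with rfl | hN
      · simp
      · rw [inv_mul_cancel₀ (by exact_mod_cast hN)]; simp
  calc ‖rokhlinMap hα u N a‖ = ‖f a‖ := rfl
    _ ≤ 4 * ‖f 1‖ * ‖a‖ := norm_le_of_positive f a
    _ ≤ 4 * 1 * ‖a‖ := by gcongr
    _ = 4 * ‖a‖ := by ring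

end ConditionalExpectation

/-! ### Counting surviving terms, iterated limits and extension by density. -/

lemma sum_sum_ite_eq_add (N d : ℕ) : (∑ l ∈ Finset.range N, ∑ k ∈ Finset.range N,
    if k = d + l then (1 : ℕ) else 0) = N - d := by
  have h : ∀ l ∈ Finset.range N, (∑ k ∈ Finset.range N, if k = d + l then (1 : ℕ) else 0) =
      if l < N - d then 1 else 0 := fun l _ => by
    rw [Finset.sum_ite_eq']
    refine if_congr ?_ rfl rfl
    rw [Finset.mem_range]
    omega
  rw [Finset.sum_congr rfl h, Finset.sum_boole]
  have : (Finset.range N).filter (fun l => l < N - d) = Finset.range (N - d) := by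
    ext l
    simp only [Finset.mem_filter, Finset.mem_range]
    omega
  simp [this]

lemma sum_sum_ite_eq_sub_natAbs (N : ℕ) (n : ℤ) : (∑ k ∈ Finset.range N, ∑ l ∈ Finset.range N,
    if (k : ℤ) = n + l then (1 : ℕ) else 0) = N - n.natAbs := by
  rcases Int.natAbs_eq n with h | h
  · rw [← sum_sum_ite_eq_add, Finset.sum_comm]
    refine Finset.sum_congr rfl fun l _ => Finset.sum_congr rfl fun k _ => if_congr ?_ rfl rfl
    omega
  · rw [← sum_sum_ite_eq_add]
    refine Finset.sum_congr rfl fun l _ => Finset.sum_congr rfl fun k _ => if_congr ?_ rfl rfl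
    omega

lemma tendsto_inv_mul_sub (d : ℕ) :
    Tendsto (fun N : ℕ => (N : ℂ)⁻¹ * ((N - d : ℕ) : ℂ)) atTop (𝓝 1) := by
  have h := (tendsto_const_nhds (x := (1 : ℂ))).sub
    (tendsto_const_div_atTop_nhds_zero_nat (𝕜 := ℂ) (d : ℂ))
  rw [sub_zero] at h
  refine h.congr' ?_
  filter_upwards [eventually_ge_atTop (d + 1)] with N hN
  have hN0 : (N : ℂ) ≠ 0 := by
    have : N ≠ 0 := by omega
    exact_mod_cast this
  rw [Nat.cast_sub (by omega)]
  field_simp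

/-- Along `atTop.curry l` the size `N` is fixed first and `j` may go as far as `N` requires, so no
uniformity in `N` is needed: the error at fixed `N` is made small through `j`, the scalar error
through `N`. -/
lemma tendsto_curry_sub {ι E : Type*} [NormedAddCommGroup E] [NormedSpace ℂ E]
    {l : Filter ι} {f : ℕ × ι → E} {w : ι → E} {K : ℝ} (hw : ∀ j, ‖w j‖ ≤ K) {r : ℕ → ℂ}
    (hr : Tendsto r atTop (𝓝 1)) (h : ∀ N, Tendsto (fun j => f (N, j) - r N • w j) l (𝓝 0)) :
    Tendsto (fun i => f i - w i.2) (atTop.curry l) (𝓝 0) := by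
  rw [Metric.tendsto_nhds]
  intro ε hε
  have h1 : Tendsto (fun N => ‖r N - 1‖ * K) atTop (𝓝 0) := by
    simpa using (tendsto_iff_norm_sub_tendsto_zero.1 hr).mul_const K
  rw [eventually_curry_iff]
  filter_upwards [h1.eventually (gt_mem_nhds (half_pos hε))] with N hN
  filter_upwards [(h N).norm.eventually (gt_mem_nhds (by simpa using half_pos hε : ‖(0 : E)‖ < ε / 2))]
    with j hj
  rw [dist_zero_right]
  calc ‖f (N, j) - w j‖ = ‖(f (N, j) - r N • w j) + (r N - 1) • w j‖ := by
        rw [sub_smul, one_smul]; simp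
    _ ≤ ‖f (N, j) - r N • w j‖ + ‖r N - 1‖ * ‖w j‖ := by
        rw [← norm_smul]; exact norm_add_le _ _
    _ ≤ ‖f (N, j) - r N • w j‖ + ‖r N - 1‖ * K := by gcongr; exact hw j
    _ < ε / 2 + ε / 2 := add_lt_add hj hN
    _ = ε := add_halves ε

/-- A bounded family of linear maps that tends to zero on subspaces spanning a dense subspace tends
to zero everywhere. -/
lemma tendsto_zero_of_dense {ι κ E F : Type*} [NormedAddCommGroup E] [NormedSpace ℂ E]
    [NormedAddCommGroup F] [NormedSpace ℂ F] {l : Filter ι} {Θ : ι → E →ₗ[ℂ] F} {K : ℝ}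
    (hK : ∀ i x, ‖Θ i x‖ ≤ K * ‖x‖) {D : κ → Submodule ℂ E}
    (hD : (⨆ k, D k).topologicalClosure = ⊤)
    (h : ∀ k, ∀ x ∈ D k, Tendsto (fun i => Θ i x) l (𝓝 0)) (x : E) :
    Tendsto (fun i => Θ i x) l (𝓝 0) := by
  let S : Submodule ℂ E :=
    { carrier := {x | Tendsto (fun i => Θ i x) l (𝓝 0)}
      add_mem' := fun {x y} hx hy => by simpa using Tendsto.add hx hy
      zero_mem' := by simpa using tendsto_const_nhds
      smul_mem' := fun c x hx => by simpa using Tendsto.const_smul hx c }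
  have hle : (⨆ k, D k) ≤ S := iSup_le fun k x hx => h k x hx
  have hx : x ∈ (⨆ k, D k).topologicalClosure := hD ▸ Submodule.mem_top
  rw [Metric.tendsto_nhds]
  intro ε hε
  have hδ : 0 < ε / (2 * (|K| + 1)) := by positivity
  obtain ⟨y, hy, hxy⟩ := Metric.mem_closure_iff.1 hx _ hδ
  have hyS : Tendsto (fun i => Θ i y) l (𝓝 0) := hle hy
  filter_upwards [hyS.norm.eventually (gt_mem_nhds (by simpa using half_pos hε : ‖(0 : F)‖ < ε / 2))]
    with i hi
  rw [dist_zero_right]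
  have h1 : ‖Θ i (x - y)‖ ≤ ε / 2 := by
    rw [dist_eq_norm, lt_div_iff₀ (by positivity)] at hxy
    have h2 : K * ‖x - y‖ ≤ (|K| + 1) * ‖x - y‖ := by
      gcongr
      linarith [le_abs_self K]
    linarith [hK i (x - y)]
  calc ‖Θ i x‖ = ‖Θ i (x - y) + Θ i y‖ := by rw [← map_add]; simp
    _ ≤ ‖Θ i (x - y)‖ + ‖Θ i y‖ := norm_add_le _ _
    _ < ε / 2 + ε / 2 := add_lt_add_of_le_of_lt h1 hi
    _ = ε := add_halves ε

/-! ### Asymptotically central unitaries. -/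

section CentralNet

variable {A ι : Type*} [CStarAlgebra A] {l : Filter ι} {u : ι → unitary A}

lemma norm_coe_unitary_le (w : unitary A) : ‖(w : A)‖ ≤ 1 := by
  rcases subsingleton_or_nontrivial A with hA | hA
  · rw [Subsingleton.elim (w : A) 0, norm_zero]; exact zero_le_one
  · exact (CStarRing.norm_of_mem_unitary w.2).le

lemma norm_coe_unitary_mul_le (w : unitary A) (a : A) : ‖(w : A) * a‖ ≤ ‖a‖ :=
  (norm_mul_le _ _).trans (mul_le_of_le_one_left (norm_nonneg _) (norm_coe_unitary_le w))

lemma norm_mul_coe_unitary_le (w : unitary A) (a : A) : ‖a * (w : A)‖ ≤ ‖a‖ :=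
  (norm_mul_le _ _).trans (mul_le_of_le_one_right (norm_nonneg _) (norm_coe_unitary_le w))

lemma tendsto_commutator_inv {a : A} (h : Tendsto (fun j => (u j : A) * a - a * u j) l (𝓝 0)) :
    Tendsto (fun j => (((u j)⁻¹ : unitary A) : A) * a - a * ((u j)⁻¹ : unitary A)) l (𝓝 0) := by
  refine squeeze_zero_norm (fun j => ?_) (by simpa using h.norm)
  have e : (((u j)⁻¹ : unitary A) : A) * a - a * ((u j)⁻¹ : unitary A) =
      -((((u j)⁻¹ : unitary A) : A) * ((u j : A) * a - a * u j) * ((u j)⁻¹ : unitary A)) := by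
    have h1 : (((u j)⁻¹ : unitary A) : A) * (u j : A) = 1 := Unitary.coe_star_mul_self (u j)
    have h2 : (u j : A) * (((u j)⁻¹ : unitary A) : A) = 1 := Unitary.coe_mul_star_self (u j)
    rw [mul_sub, sub_mul, ← mul_assoc, h1, one_mul, ← mul_assoc, mul_assoc _ (u j : A), h2, mul_one]
    abel
  rw [e, norm_neg]
  exact (norm_mul_coe_unitary_le _ _).trans (norm_coe_unitary_mul_le _ _)

lemma tendsto_commutator_mul {v : ι → unitary A} {a : A}
    (h : Tendsto (fun j => (u j : A) * a - a * u j) l (𝓝 0))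
    (h' : Tendsto (fun j => (v j : A) * a - a * v j) l (𝓝 0)) :
    Tendsto (fun j => ((u j * v j : unitary A) : A) * a - a * (u j * v j : unitary A)) l (𝓝 0) := by
  have h3 := h.norm.add h'.norm
  rw [norm_zero, add_zero] at h3
  refine squeeze_zero_norm (fun j => ?_) h3
  have e : ((u j * v j : unitary A) : A) * a - a * (u j * v j : unitary A) =
      ((u j : A) * a - a * u j) * v j + u j * ((v j : A) * a - a * v j) := by
    rw [Submonoid.coe_mul]; noncomm_ring
  rw [e]
  exact (norm_add_le _ _).trans
    (add_le_add (norm_mul_coe_unitary_le _ _) (norm_coe_unitary_mul_le _ _))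

lemma tendsto_commutator_pow {a : A} (h : Tendsto (fun j => (u j : A) * a - a * u j) l (𝓝 0))
    (k : ℕ) : Tendsto (fun j => ((u j ^ k : unitary A) : A) * a - a * (u j ^ k : unitary A)) l
      (𝓝 0) := by
  induction k with
  | zero => simpa using tendsto_const_nhds
  | succ k ih =>
    simp only [pow_succ]
    exact tendsto_commutator_mul ih h

lemma tendsto_commutator_zpow {a : A} (h : Tendsto (fun j => (u j : A) * a - a * u j) l (𝓝 0))
    (n : ℤ) : Tendsto (fun j => ((u j ^ n : unitary A) : A) * a - a * (u j ^ n : unitary A)) l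
      (𝓝 0) := by
  obtain ⟨k, rfl | rfl⟩ := n.eq_nat_or_neg
  · simpa only [zpow_natCast] using tendsto_commutator_pow h k
  · simp only [zpow_neg, zpow_natCast]
    exact tendsto_commutator_inv (tendsto_commutator_pow h k)

variable {α : Circle →* (A ≃⋆ₐ[ℂ] A)} (hα : ∀ a : A, Continuous fun ζ : Circle => α ζ a)

/-- Each surviving term `u⁻ᵏ a uˡ` has `k = n + l`; moving `uˡ` to the left of `a` turns it into
`u⁻ⁿ a`. There are `N - |n|` such terms, and for fixed `N` the finitely many commutators tend to
zero. -/
lemma tendsto_rokhlinMap_sub (hu : ∀ j, (u j : A) ∈ spectralSubspace α 1) {a : A}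
    (h : Tendsto (fun j => (u j : A) * a - a * u j) l (𝓝 0)) {n : ℤ}
    (ha : a ∈ spectralSubspace α n) (N : ℕ) :
    Tendsto (fun j => (rokhlinMap hα (u j) N a : A) -
      ((N : ℂ)⁻¹ * ((N - n.natAbs : ℕ) : ℂ)) • (((u j ^ (-n) : unitary A) : A) * a)) l (𝓝 0) := by
  have key : ∀ j, (rokhlinMap hα (u j) N a : A) -
      ((N : ℂ)⁻¹ * ((N - n.natAbs : ℕ) : ℂ)) • (((u j ^ (-n) : unitary A) : A) * a) =
      (N : ℂ)⁻¹ • ∑ k ∈ Finset.range N, ∑ l ∈ Finset.range N,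
        if (k : ℤ) = n + l then
          -((((u j)⁻¹ ^ k : unitary A) : A) *
            (((u j ^ l : unitary A) : A) * a - a * (u j ^ l : unitary A))) else 0 := fun j => by
    rw [coe_rokhlinMap, circleAverage_compression hα (hu j) ha, mul_smul, ← smul_sub,
      Nat.cast_smul_eq_nsmul, ← sum_sum_ite_eq_sub_natAbs, Finset.sum_smul,
      ← Finset.sum_sub_distrib]
    congr 1
    refine Finset.sum_congr rfl fun k _ => ?_
    rw [Finset.sum_smul, ← Finset.sum_sub_distrib]
    refine Finset.sum_congr rfl fun l _ => ?_
    split_ifs with hkl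
    · have e : u j ^ (-n) = (u j)⁻¹ ^ k * u j ^ l := by
        rw [inv_pow, ← zpow_natCast, ← zpow_natCast, ← zpow_neg, ← zpow_add]
        congr 1
        omega
      rw [e, one_smul]
      change _ = -((star (u j : A)) ^ k * _)
      change _ - (star (u j : A)) ^ k * (u j : A) ^ l * a = -(_ * ((u j : A) ^ l * a - a * (u j : A) ^ l))
      noncomm_ring
    · simp
  simp only [key]
  have h0 : Tendsto (fun j => (N : ℂ)⁻¹ • ∑ k ∈ Finset.range N, ∑ l ∈ Finset.range N,
        if (k : ℤ) = n + l then
          -((((u j)⁻¹ ^ k : unitary A) : A) *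
            (((u j ^ l : unitary A) : A) * a - a * (u j ^ l : unitary A))) else 0) l
      (𝓝 ((N : ℂ)⁻¹ • ∑ k ∈ Finset.range N, ∑ l ∈ Finset.range N, (0 : A))) := by
    refine Tendsto.const_smul (tendsto_finsetSum _ fun k _ => tendsto_finsetSum _ fun m _ => ?_) _
    split_ifs
    · refine squeeze_zero_norm (fun j => ?_) (by simpa using (tendsto_commutator_pow h m).norm)
      rw [norm_neg]
      exact norm_coe_unitary_mul_le _ _
    · exact tendsto_const_nhds
  simpa using h0

end CentralNet

/-! ### The asymptotic retraction onto the fixed point algebra. -/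

section Main

variable {A : Type*} [CStarAlgebra A] {α : Circle →* (A ≃⋆ₐ[ℂ] A)}

open CStarK in
/-- A continuous circle action with the Rokhlin property admits asymptotically multiplicative
retractions onto its fixed point algebra. -/
lemma HasRokhlinProperty.exists_asympRetract (hR : HasRokhlinProperty α)
    (hα : ∀ a : A, Continuous fun ζ : Circle => α ζ a) :
    ∃ (l : Filter (ℕ × (Finset A × ℕ))) (ψ : ℕ × (Finset A × ℕ) → A →ₗ[ℂ] fixedPointAlgebra α),
      l.NeBot ∧ AsympRetract l (fixedPointAlgebra α).subtype ψ := by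
  classical
  obtain ⟨u, hu, hc⟩ := hR.exists_net hα
  -- An iterated limit: the unitaries must become central at a rate depending on `N`, so a product
  -- filter would not suit the estimates.
  let l : Filter (ℕ × (Finset A × ℕ)) := atTop.curry atTop
  have hl : l.NeBot := by
    refine ⟨fun h => ?_⟩
    have h' : ∀ᶠ _ in l, False := by rw [h]; exact eventually_bot
    obtain ⟨N, hN⟩ := (eventually_curry_iff.1 h').exists
    exact hN.exists.elim fun _ h => h
  have hsnd : Tendsto Prod.snd l atTop := tendsto_snd.mono_left curry_le_prod
  let ψ : ℕ × (Finset A × ℕ) → A →ₗ[ℂ] fixedPointAlgebra α := fun i => rokhlinMap hα (u i.2) i.1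
  have hb : ∀ i a, ‖ψ i a‖ ≤ 4 * ‖a‖ := fun i a => norm_rokhlinMap_le hα (hu i.2) (u i.2).2 i.1 a
  have hasymp : ∀ (n : ℤ) (a : A), a ∈ spectralSubspace α n →
      Tendsto (fun i => (ψ i a : A) - ((u i.2 ^ (-n) : unitary A) : A) * a) l (𝓝 0) :=
    fun n a ha => tendsto_curry_sub (f := fun i => (ψ i a : A))
      (w := fun j => ((u j ^ (-n) : unitary A) : A) * a)
      (fun j => norm_coe_unitary_mul_le _ a) (tendsto_inv_mul_sub n.natAbs)
      (tendsto_rokhlinMap_sub hα hu (hc a) ha)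
  have hdense := topologicalClosure_iSup_spectralSubspace hα
  have hmul₀ : ∀ (m n : ℤ) (a b : A), a ∈ spectralSubspace α m → b ∈ spectralSubspace α n →
      Tendsto (fun i => (ψ i (a * b) : A) - ψ i a * ψ i b) l (𝓝 0) := by
    intro m n a b ha hb'
    have h1 := hasymp _ _ (mul_mem_spectralSubspace ha hb')
    have h2 := hasymp _ _ ha
    have h3 := hasymp _ _ hb'
    -- The defect of `a ↦ u⁻ⁿ a` on homogeneous elements is `u⁻ᵐ (u⁻ⁿ a - a u⁻ⁿ) b`, so centrality
    -- is used here.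
    have h4 := (tendsto_commutator_zpow (hc a) (-n)).comp hsnd
    have b1 : l.IsBoundedUnder (· ≤ ·) (norm ∘ fun i => (ψ i b : A)) :=
      isBoundedUnder_of ⟨4 * ‖b‖, fun i => hb i b⟩
    have b2 : l.IsBoundedUnder (· ≤ ·)
        (norm ∘ fun i => ((u i.2 ^ (-m) : unitary A) : A) * a) :=
      isBoundedUnder_of ⟨‖a‖, fun i => norm_coe_unitary_mul_le _ a⟩
    have b3 : l.IsBoundedUnder (· ≤ ·) (norm ∘ fun _ => b) := isBoundedUnder_of ⟨‖b‖, fun _ => le_rfl⟩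
    have b4 : l.IsBoundedUnder (· ≤ ·) (norm ∘ fun i => ((u i.2 ^ (-m) : unitary A) : A)) :=
      isBoundedUnder_of ⟨1, fun i => norm_coe_unitary_le _⟩
    have h5 := h2.zero_mul_isBoundedUnder_le b1
    have h6 := isBoundedUnder_le_mul_tendsto_zero b2 h3
    have h7 := isBoundedUnder_le_mul_tendsto_zero b4 (h4.zero_mul_isBoundedUnder_le b3)
    have h8 := ((h1.sub h5).sub h6).add h7
    simp only [sub_zero, add_zero] at h8
    refine h8.congr fun i => ?_
    have e : ((u i.2 ^ (-(m + n)) : unitary A) : A) =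
        ((u i.2 ^ (-m) : unitary A) : A) * ((u i.2 ^ (-n) : unitary A) : A) := by
      rw [← Submonoid.coe_mul, ← zpow_add, neg_add]
    rw [e]
    simp only [Function.comp_apply]
    noncomm_ring
  -- Multiplicativity extends from homogeneous pairs by density in one variable at a time, since for
  -- a fixed factor the defect is linear in the other. The bound `20` is `4 + 4 · 4`.
  have hmul₁ : ∀ (m : ℤ) (a : A), a ∈ spectralSubspace α m → ∀ b,
      Tendsto (fun i => ψ i (a * b) - ψ i a * ψ i b) l (𝓝 0) := by
    intro m a ha b
    refine tendsto_zero_of_dense (K := 20 * ‖a‖)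
      (Θ := fun i => (ψ i).comp (LinearMap.mulLeft ℂ a) -
        (LinearMap.mulLeft ℂ (ψ i a)).comp (ψ i)) (fun i x => ?_) hdense (fun n x hx => ?_) b
    · change ‖ψ i (a * x) - ψ i a * ψ i x‖ ≤ _
      calc _ ≤ 4 * (‖a‖ * ‖x‖) + 4 * ‖a‖ * (4 * ‖x‖) :=
            (norm_sub_le _ _).trans (add_le_add ((hb i _).trans (by gcongr; exact norm_mul_le _ _))
              ((norm_mul_le _ _).trans (mul_le_mul (hb i a) (hb i x) (norm_nonneg _)
                (by positivity))))
        _ = 20 * ‖a‖ * ‖x‖ := by ring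
    · exact Topology.IsEmbedding.subtypeVal.tendsto_nhds_iff.2 (hmul₀ m n a x ha hx)
  refine ⟨l, ψ, hl, fun i a => rokhlinMap_star hα _ _ a, ⟨4, by norm_num, hb⟩, fun a b => ?_,
    fun b => ?_⟩
  · refine tendsto_zero_of_dense (K := 20 * ‖b‖)
      (Θ := fun i => (ψ i).comp (LinearMap.mulRight ℂ b) -
        (LinearMap.mulRight ℂ (ψ i b)).comp (ψ i)) (fun i x => ?_) hdense
      (fun n x hx => hmul₁ n x hx b) a
    change ‖ψ i (x * b) - ψ i x * ψ i b‖ ≤ _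
    calc _ ≤ 4 * (‖x‖ * ‖b‖) + 4 * ‖x‖ * (4 * ‖b‖) :=
          (norm_sub_le _ _).trans (add_le_add ((hb i _).trans (by gcongr; exact norm_mul_le _ _))
            ((norm_mul_le _ _).trans (mul_le_mul (hb i x) (hb i b) (norm_nonneg _)
              (by positivity))))
      _ = 20 * ‖b‖ * ‖x‖ := by ring
  · refine Topology.IsEmbedding.subtypeVal.tendsto_nhds_iff.2 ?_
    -- Fixed elements have degree zero, where the approximating map `u⁰ b` is the identity.
    have h := hasymp 0 b (mem_fixedPointAlgebra_iff.1 b.2)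
    have h2 := h.add_const (b : A)
    simp only [neg_zero, zpow_zero, OneMemClass.coe_one, one_mul, sub_add_cancel, zero_add] at h2
    exact h2

end Main

end

theorem mainTheorem7 {A : Type*} [CStarAlgebra A] (α : Circle →* (A ≃⋆ₐ[ℂ] A))
    (hα : ∀ a : A, Continuous fun ζ : Circle => α ζ a) (hR : HasRokhlinProperty α) :
    (Function.Injective (CStarK.K0.map (fixedPointAlgebra α).subtype) ∧
      Function.Injective (CStarK.K1.map (fixedPointAlgebra α).subtype)) ∧
    (AddGroup.FG (CStarK.K0 A) →
      ∃ π : CStarK.K0 A →+ CStarK.K0 (fixedPointAlgebra α),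
        π.comp (CStarK.K0.map (fixedPointAlgebra α).subtype) = AddMonoidHom.id _) ∧
    (AddGroup.FG (CStarK.K1 A) →
      ∃ π : CStarK.K1 A →+ CStarK.K1 (fixedPointAlgebra α),
        π.comp (CStarK.K1.map (fixedPointAlgebra α).subtype) = AddMonoidHom.id _) ∧
    (CStarK.K0.map (fixedPointAlgebra α).subtype).range.IsPure ∧
    (CStarK.K1.map (fixedPointAlgebra α).subtype).range.IsPure := by
  obtain ⟨l, ψ, hl, H⟩ := hR.exists_asympRetract hα
  have h0 := H.exists_nsmul_K0
  have h1 := H.exists_nsmul_K1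
  exact ⟨⟨injective_of_nsmul_lift h0, injective_of_nsmul_lift h1⟩,
    fun _ => exists_retraction_of_nsmul_lift h0, fun _ => exists_retraction_of_nsmul_lift h1,
    isPure_range_of_nsmul_lift h0, isPure_range_of_nsmul_lift h1⟩
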